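/- All graphs are finite and simple, and $C_m$ denotes the cycle on $m$ vertices. A graph is $\mathcal{H}$-free, for a family $\mathcal{H}$ of graphs, if it contains no member of $\mathcal{H}$ as a (not necessarily induced) subgraph. For positive integers $r,k$, an $(r,k)$-graph is a graph whose vertex set can be partitioned into exactly $r$ nonempty parts, each of size at most $k$, such that there is at least one edge between any two distinct parts. Let $f(r,\mathcal{H})$ be the minimum $k$ such that there is an $\mathcal{H}$-free $(r,k)$-graph. Then the following hold. (a) There is an infinite set $S$ of non-negative integers, containing all numbers $2^{2(2e+1)}$ with $e \ge 1$ an integer, such that $$f(r,\{C_4,C_6\}) = (1+o(1))\, r^{1/2} \qquad (r\to\infty,\ r\in S).$$ (b) There is an infinite set $T$ of non-negative integers, containing all numbers $3^{3(2e+1)}$ with $e \ge 1$ an integer, such that $$f(\rho,\{C_4,C_6,C_8,C_{10}\}) = (1+o(1))\, \rho^{2/3} \qquad (\rho\to\infty,\ \rho\in T).$$ -/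

import Mathlib

namespace CompletePartition

/-- A complete partition of the finite graph `G` into `r` parts: a partition of the vertex set
into `r` (nonempty) parts with at least one edge of `G` between any two distinct parts. The parts
need not be independent sets. -/
def IsCompletePartition {V : Type*} [Fintype V] [DecidableEq V] (G : SimpleGraph V) (r : ℕ)
    (P : Finpartition (Finset.univ : Finset V)) : Prop :=
  P.parts.card = r ∧
    ∀ A ∈ P.parts, ∀ B ∈ P.parts, A ≠ B → ∃ a ∈ A, ∃ b ∈ B, G.Adj a b

/-- `G` is an `(r, k)`-graph: it has a complete partition into `r` parts, each of size at
most `k`. -/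
def IsRKGraph {V : Type*} [Fintype V] [DecidableEq V] (G : SimpleGraph V) (r k : ℕ) : Prop :=
  ∃ P : Finpartition (Finset.univ : Finset V),
    IsCompletePartition G r P ∧ ∀ A ∈ P.parts, A.card ≤ k

/-- A family of finite graphs. -/
abbrev Family : Type := Set (Σ m : ℕ, SimpleGraph (Fin m))

/-- `G` is `𝓗`-free: no member of `𝓗` is a (not necessarily induced) subgraph of `G`. -/
def FamilyFree (𝓗 : Family) {V : Type*} (G : SimpleGraph V) : Prop :=
  ∀ H ∈ 𝓗, H.2.Free G

/-- `f r 𝓗` is the least `k` for which there is a (finite) `𝓗`-free `(r, k)`-graph. -/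
noncomputable def f (r : ℕ) (𝓗 : Family) : ℕ :=
  sInf {k : ℕ | ∃ (n : ℕ) (G : SimpleGraph (Fin n)), FamilyFree 𝓗 G ∧ IsRKGraph G r k}

/-- The cycle `C_m`, as a member of a family of graphs (used for `m ≥ 3`). -/
def C (m : ℕ) : Σ m : ℕ, SimpleGraph (Fin m) := ⟨m, SimpleGraph.cycleGraph m⟩

end CompletePartition

open scoped Asymptotics

/-! Lower bounds. An `(r, k)`-graph has at most `r * k` vertices and at least `r * (r - 1)` darts
(ordered adjacent pairs), so its average degree D is at least (r-1)/k. Odd cycles are allowed, but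
excluding the short even ones leaves each dart at most two bad continuations: backtracking, and one
vertex on a triangle (or pentagon). By an entropy argument (`le_dartSum_steps`) there are at least
(D - O(1)) D^j n good walks with j+1 edges. For j = 2 in (a) and j = 4 in (b) such walks are
determined by their ends, so there are at most n² of them. Hence roughly (r/k)^(j+1) ≤ rk, which is
k ≥ r^(1/2), respectively k ≥ r^(2/3).

Upper bounds. Over a field of order q = p^(2e+1) some endomorphism σ squares to the Frobenius. For p
= 2 and p = 3 it yields a polarity of the affine symplectic quadrangle, respectively of the affine
split Cayley hexagon, and the polarity graph has no cycle of the forbidden lengths. The parts are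
the balls of radius 1 (radius 2) around the self-related vertices: q² parts of size at most q,
respectively q³ parts of size at most q². A short walk between two self-related vertices, run there
and back with the loops at both ends, would be a forbidden closed walk, so the balls are disjoint.
Solving explicit equations over the field shows that each ball is joined to all but O(q),
respectively O(q²), of the others.

The missing pairs form a graph on the parts whose maximum degree is of the order of the part size g.
It lifts to a graph without short cycles having only o(g) vertices over each part
(`exists_cover_free_cycleGraph`). Placing this lift beside the polarity graph supplies the missing
edges at negligible cost. -/

namespace SimpleGraph

/-! ### Cycles as closed sequences of vertices -/

variable {V W : Type*}

/-- A graph contains the cycle of length `m` iff its vertices can be listed along such a cycle. -/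
theorem cycleGraph_isContained_iff_exists_nat {G : SimpleGraph V} {m : ℕ} (hm : 3 ≤ m) :
    cycleGraph m ⊑ G ↔ ∃ f : ℕ → V, (∀ i < m, ∀ j < m, f i = f j → i = j) ∧
      (∀ i, i + 1 < m → G.Adj (f i) (f (i + 1))) ∧ G.Adj (f (m - 1)) (f 0) := by
  obtain ⟨n, rfl⟩ : ∃ n, m = n + 2 := ⟨m - 2, by omega⟩
  constructor
  · rintro ⟨φ⟩
    refine ⟨fun i => φ (Fin.ofNat (n + 2) i), ?_, ?_, ?_⟩
    · intro i hi j hj h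
      have := congrArg Fin.val (φ.injective h)
      simpa [Fin.ofNat, Nat.mod_eq_of_lt hi, Nat.mod_eq_of_lt hj] using this
    · intro i hi
      refine φ.toHom.map_adj ?_
      rw [cycleGraph_adj]
      right
      ext
      simp [Fin.ofNat, Fin.sub_def, Nat.mod_eq_of_lt hi, Nat.mod_eq_of_lt (Nat.lt_of_succ_lt hi)]
      rw [show n + 2 - i + (i + 1) = 1 + (n + 2) by omega, Nat.add_mod_right]
      simp
    · refine φ.toHom.map_adj ?_
      rw [cycleGraph_adj]
      right
      rw [sub_eq_iff_eq_add]
      ext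
      simp [Fin.ofNat, Fin.val_add, show 1 + (n + 1) = n + 2 by omega]
  · rintro ⟨f, hinj, hadj, hlast⟩
    refine ⟨⟨⟨fun i => f i, ?_⟩, ?_⟩⟩
    · have key : ∀ a b : Fin (n + 2), a - b = 1 → G.Adj (f a) (f b) := by
        intro a b h
        have h1 : a = b + 1 := by exact (sub_eq_iff_eq_add.1 h).trans (add_comm _ _)
        by_cases hb : (b : ℕ) + 1 < n + 2
        · have : (a : ℕ) = b + 1 := by
            rw [h1, Fin.val_add, Fin.val_one, Nat.mod_eq_of_lt hb]
          rw [this]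
          exact (hadj _ hb).symm
        · have hb' : (b : ℕ) = n + 1 := by omega
          have : (a : ℕ) = 0 := by
            rw [h1, Fin.val_add, Fin.val_one, hb']; simp
          rw [this, hb']
          exact hlast.symm
      intro a b h
      rw [cycleGraph_adj] at h
      rcases h with h | h
      · exact key a b h
      · exact (key b a h).symm
    · intro a b h
      exact Fin.ext (hinj _ a.2 _ b.2 h)

/-- In a `C_m`-free graph no duplicate-free list of length `m` is a closed chain. -/
theorem Free.not_adj_getLast {G : SimpleGraph V} {m : ℕ} (hG : (cycleGraph m).Free G)
    (a : V) (l : List V) (hl : (a :: l).Nodup) (hm : 3 ≤ m) (hlen : (a :: l).length = m)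
    (hc : (a :: l).IsChain G.Adj) : ¬ G.Adj ((a :: l).getLast (by simp)) a := by
  intro h
  refine hG ((cycleGraph_isContained_iff_exists_nat hm).2 ⟨fun i => (a :: l).getD i a, ?_, ?_, ?_⟩)
  · intro i hi j hj hij
    rw [← hlen] at hi hj
    simp only at hij
    rw [List.getD_eq_getElem _ _ hi, List.getD_eq_getElem _ _ hj] at hij
    exact (hl.getElem_inj_iff).1 hij
  · intro i hi
    rw [← hlen] at hi
    simp only
    rw [List.getD_eq_getElem _ _ hi, List.getD_eq_getElem _ _ (Nat.lt_of_succ_lt hi)]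
    exact List.isChain_iff_getElem.1 hc i hi
  · have h2 : m - 1 < (a :: l).length := by omega
    simp only
    rw [List.getD_eq_getElem _ _ h2]
    rw [List.getLast_eq_getElem] at h
    simpa [← hlen] using h

theorem Free.false_of_cycle_four {G : SimpleGraph V} (hG : (cycleGraph 4).Free G) {a b c d : V}
    (hab : G.Adj a b) (hbc : G.Adj b c) (hcd : G.Adj c d) (hda : G.Adj d a)
    (hac : a ≠ c) (hbd : b ≠ d) : False := by
  refine hG.not_adj_getLast a [b, c, d] ?_ (by norm_num) rfl ?_ hda
  · simp [hab.ne, hac, hda.ne', hbc.ne, hbd, hcd.ne]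
  · simp [hab, hbc, hcd]

/-- A cycle is connected, so it stays in the summand that contains its first vertex. -/
theorem free_sum_cycleGraph {G : SimpleGraph V} {H : SimpleGraph W} {m : ℕ} (hm : 3 ≤ m)
    (hG : (cycleGraph m).Free G) (hH : (cycleGraph m).Free H) :
    (cycleGraph m).Free (G ⊕g H) := by
  rintro hc
  obtain ⟨f, hinj, hadj, hlast⟩ := (cycleGraph_isContained_iff_exists_nat hm).1 hc
  rcases h0 : f 0 with v | w
  · have hl : ∀ i, i < m → ∃ v, f i = Sum.inl v := by
      intro i
      induction i with
      | zero => exact fun _ => ⟨v, h0⟩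
      | succ i ih =>
        intro hi
        obtain ⟨x, hx⟩ := ih (by omega)
        have := hadj i hi
        rw [hx] at this
        rcases h1 : f (i + 1) with y | y
        · exact ⟨y, rfl⟩
        · rw [h1] at this; simp at this
    have : Nonempty V := ⟨v⟩
    choose! g hg using hl
    refine hG ((cycleGraph_isContained_iff_exists_nat hm).2 ⟨g, ?_, ?_, ?_⟩)
    · intro i hi j hj h
      exact hinj i hi j hj (by rw [hg i hi, hg j hj, h])
    · intro i hi
      have := hadj i hi
      rwa [hg i (by omega), hg _ hi, sum_adj_inl] at this
    · have := hlast
      rwa [hg _ (by omega), hg 0 (by omega), sum_adj_inl] at this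
  · have hl : ∀ i, i < m → ∃ v, f i = Sum.inr v := by
      intro i
      induction i with
      | zero => exact fun _ => ⟨w, h0⟩
      | succ i ih =>
        intro hi
        obtain ⟨x, hx⟩ := ih (by omega)
        have := hadj i hi
        rw [hx] at this
        rcases h1 : f (i + 1) with y | y
        · rw [h1] at this; simp at this
        · exact ⟨y, rfl⟩
    have : Nonempty W := ⟨w⟩
    choose! g hg using hl
    refine hH ((cycleGraph_isContained_iff_exists_nat hm).2 ⟨g, ?_, ?_, ?_⟩)
    · intro i hi j hj h
      exact hinj i hi j hj (by rw [hg i hi, hg j hj, h])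
    · intro i hi
      have := hadj i hi
      rwa [hg i (by omega), hg _ hi, sum_adj_inr] at this
    · have := hlast
      rwa [hg _ (by omega), hg 0 (by omega), sum_adj_inr] at this

end SimpleGraph

/-! ### Complete partitions: construction from parts and counting bounds -/

namespace CompletePartition

open Finset

/-- Disjoint nonempty parts of size at most `k`, pairwise joined by an edge of an `𝓗`-free graph,
make up an `𝓗`-free `(r, k)`-graph. -/
theorem exists_isRKGraph_of_disjoint_parts {V I : Type*} [Fintype V] [DecidableEq V] [Fintype I]
    {G : SimpleGraph V} {𝓗 : Family} (hG : FamilyFree 𝓗 G) (P : I → Finset V) {k : ℕ}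
    (hdisj : ∀ i j, i ≠ j → Disjoint (P i) (P j)) (hne : ∀ i, (P i).Nonempty)
    (hcard : ∀ i, (P i).card ≤ k)
    (hadj : ∀ i j, i ≠ j → ∃ a ∈ P i, ∃ b ∈ P j, G.Adj a b) :
    ∃ (n : ℕ) (G' : SimpleGraph (Fin n)), FamilyFree 𝓗 G' ∧ IsRKGraph G' (Fintype.card I) k := by
  classical
  -- The parts need not cover `V`: the graph is restricted to their union and transported to some
  -- `Fin n`.
  let U := {v : V // ∃ i, v ∈ P i}
  let e : Fin (Fintype.card U) ≃ U := (Fintype.equivFin U).symm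
  let φ : Fin (Fintype.card U) ↪ V := ⟨fun x => (e x).1, Subtype.val_injective.comp e.injective⟩
  have hφ : ∀ i, ∀ v ∈ P i, ∃ x, φ x = v := fun i v hv =>
    ⟨e.symm ⟨v, i, hv⟩, by simp [φ]⟩
  let Q : I → Finset (Fin (Fintype.card U)) := fun i => univ.filter fun x => φ x ∈ P i
  have hQne : ∀ i, (Q i).Nonempty := by
    intro i
    obtain ⟨v, hv⟩ := hne i
    obtain ⟨x, hx⟩ := hφ i v hv
    exact ⟨x, by simp [Q, hx, hv]⟩
  have hQdisj : ∀ i j, i ≠ j → Disjoint (Q i) (Q j) := by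
    intro i j hij
    rw [Finset.disjoint_left]
    intro x hx hx'
    simp only [Q, mem_filter, mem_univ, true_and] at hx hx'
    exact Finset.disjoint_left.1 (hdisj i j hij) hx hx'
  have hQinj : Function.Injective Q := by
    intro i j hij
    by_contra hne'
    have := hQdisj i j hne'
    rw [hij, disjoint_self] at this
    exact (hQne j).ne_empty this
  refine ⟨Fintype.card U, G.comap φ, ?_, ?_⟩
  · intro H hH hc
    exact hG H hH (hc.trans ⟨(SimpleGraph.Embedding.comap φ G).toCopy⟩)
  · refine ⟨Finpartition.ofExistsUnique (univ.image Q) (fun _ _ => subset_univ _) ?_ ?_,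
      ⟨?_, ?_⟩, ?_⟩
    · intro x _
      obtain ⟨i, hi⟩ := (e x).2
      refine ⟨Q i, ⟨mem_image_of_mem _ (mem_univ _), by simpa [Q, φ] using hi⟩, ?_⟩
      rintro A ⟨hA, hxA⟩
      obtain ⟨j, -, rfl⟩ := mem_image.1 hA
      by_contra hne'
      have hij : i ≠ j := fun h => hne' (by rw [h])
      exact Finset.disjoint_left.1 (hQdisj i j hij) (by simpa [Q, φ] using hi) hxA
    · intro h
      obtain ⟨j, -, hj⟩ := mem_image.1 h
      exact (hQne j).ne_empty hj
    · change (univ.image Q).card = _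
      rw [card_image_of_injective _ hQinj, card_univ]
    · intro A hA B hB hAB
      obtain ⟨i, -, rfl⟩ := mem_image.1 (show A ∈ univ.image Q from hA)
      obtain ⟨j, -, rfl⟩ := mem_image.1 (show B ∈ univ.image Q from hB)
      obtain ⟨a, ha, b, hb, hab⟩ := hadj i j (fun h => hAB (by rw [h]))
      obtain ⟨x, rfl⟩ := hφ i a ha
      obtain ⟨y, rfl⟩ := hφ j b hb
      exact ⟨x, by simpa [Q] using ha, y, by simpa [Q] using hb, hab⟩
    · intro A hA
      obtain ⟨i, -, rfl⟩ := mem_image.1 (show A ∈ univ.image Q from hA)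
      refine le_trans ?_ (hcard i)
      refine card_le_card_of_injOn φ ?_ φ.injective.injOn
      intro x hx
      simpa [Q] using hx

/-- An `(r, k)`-graph has at most `r * k` vertices and at least `r * (r - 1)` ordered pairs of
adjacent vertices. -/
theorem IsRKGraph.card_bounds {n : ℕ} {G : SimpleGraph (Fin n)} [DecidableRel G.Adj] {r k : ℕ}
    (h : IsRKGraph G r k) :
    n ≤ r * k ∧ r * (r - 1) ≤ (univ.filter fun x : Fin n × Fin n => G.Adj x.1 x.2).card := by
  classical
  obtain ⟨P, ⟨hr, hadj⟩, hk⟩ := h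
  constructor
  · have := P.sum_card_parts
    rw [card_univ, Fintype.card_fin] at this
    rw [← this, ← hr]
    exact (sum_le_card_nsmul _ _ _ hk).trans_eq (by simp)
  · have hoff : P.parts.offDiag.card = r * (r - 1) := by
      rw [offDiag_card, hr, Nat.mul_sub, mul_one]
    rw [← hoff]
    -- One dart is chosen for each ordered pair of distinct parts; its ends determine the two parts,
    -- so the choice is injective.
    have hex : ∀ x ∈ P.parts.offDiag, ∃ y : Fin n × Fin n,
        y.1 ∈ x.1 ∧ y.2 ∈ x.2 ∧ G.Adj y.1 y.2 := by
      intro x hx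
      rw [mem_offDiag] at hx
      obtain ⟨a, ha, b, hb, hab⟩ := hadj _ hx.1 _ hx.2.1 hx.2.2
      exact ⟨(a, b), ha, hb, hab⟩
    rcases P.parts.offDiag.eq_empty_or_nonempty with h0 | ⟨x₀, hx₀⟩
    · simp [h0]
    have : Nonempty (Fin n × Fin n) := ⟨(hex x₀ hx₀).choose⟩
    choose! g hg using hex
    refine card_le_card_of_injOn g ?_ ?_
    · intro x hx
      simpa using (hg x hx).2.2
    · intro x hx y hy hxy
      have hx' := hg x hx
      have hy' := hg y hy
      rw [mem_coe, mem_offDiag] at hx hy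
      rw [← hxy] at hy'
      exact Prod.ext (P.eq_of_mem_parts hx.1 hy.1 hx'.1 hy'.1)
        (P.eq_of_mem_parts hx.2.1 hy.2.1 hx'.2.1 hy'.2.1)

end CompletePartition

/-! ### Lifting a graph of bounded degree to one without short cycles -/

namespace SimpleGraph

open Finset

variable {V : Type*}

/-- Joining two vertices at distance at least `L` creates no cycle of length at most `L`. -/
theorem free_cycleGraph_sup_edge {G : SimpleGraph V} {u v : V} {L : ℕ}
    (hG : ∀ m, 3 ≤ m → m ≤ L → (cycleGraph m).Free G)
    (huv : ∀ (g : ℕ → V) (k : ℕ), k < L → g 0 = u → g k = v →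
      ¬ ∀ i < k, G.Adj (g i) (g (i + 1)))
    (m : ℕ) (hm : 3 ≤ m) (hmL : m ≤ L) : (cycleGraph m).Free (G ⊔ edge u v) := by
  intro hc
  obtain ⟨f, hinj, hadj, hlast⟩ := (cycleGraph_isContained_iff_exists_nat hm).1 hc
  have hmod : ∀ a, a < 2 * m → a % m = if a < m then a else a - m := by
    intro a ha
    split_ifs with h
    · exact Nat.mod_eq_of_lt h
    · rw [Nat.mod_eq_sub_mod (by omega), Nat.mod_eq_of_lt (by omega)]
  have hstep : ∀ a, (G ⊔ edge u v).Adj (f (a % m)) (f ((a + 1) % m)) := by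
    intro a
    have ha : a % m < m := Nat.mod_lt _ (by omega)
    rw [Nat.add_mod, Nat.mod_eq_of_lt (show 1 < m by omega)]
    by_cases h : a % m + 1 < m
    · rw [Nat.mod_eq_of_lt h]
      exact hadj _ h
    · have h1 : a % m = m - 1 := by omega
      rw [h1, show m - 1 + 1 = m by omega, Nat.mod_self]
      exact hlast
  -- A cycle avoiding the new edge lies in `G`. Otherwise removing that edge leaves a walk of length
  -- m - 1 < L in `G` between `u` and `v`.
  by_cases hall : ∀ a < m, G.Adj (f (a % m)) (f ((a + 1) % m))
  · refine hG m hm hmL ((cycleGraph_isContained_iff_exists_nat hm).2 ⟨f, hinj, ?_, ?_⟩)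
    · intro i hi
      simpa [Nat.mod_eq_of_lt hi, Nat.mod_eq_of_lt (Nat.lt_of_succ_lt hi)] using
        hall i (by omega)
    · have := hall (m - 1) (by omega)
      rwa [show m - 1 + 1 = m by omega, Nat.mod_self, Nat.mod_eq_of_lt (by omega)] at this
  push Not at hall
  obtain ⟨a, ha, hna⟩ := hall
  have hedge : ∀ b, ¬ G.Adj (f (b % m)) (f ((b + 1) % m)) →
      (f (b % m) = u ∧ f ((b + 1) % m) = v) ∨ (f (b % m) = v ∧ f ((b + 1) % m) = u) := by
    intro b hb
    have := hstep b
    rw [sup_adj, edge_adj] at this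
    rcases this with h | ⟨h, -⟩
    · exact absurd h hb
    · exact h.imp id id
  -- A second use of the new edge would repeat both its ends, in one order or the other; injectivity
  -- of `f` and 3 ≤ m exclude this.
  have hpath : ∀ j < m - 1, G.Adj (f ((a + 1 + j) % m)) (f ((a + 1 + (j + 1)) % m)) := by
    intro j hj
    by_contra hcon
    have e1 := hedge _ hna
    have e2 := hedge _ hcon
    have hlt : ∀ b, b % m < m := fun b => Nat.mod_lt _ (by omega)
    have key : (f (a % m) = f ((a + 1 + j) % m) ∧ f ((a + 1) % m) = f ((a + 1 + j + 1) % m)) ∨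
        (f (a % m) = f ((a + 1 + j + 1) % m) ∧ f ((a + 1) % m) = f ((a + 1 + j) % m)) := by
      rcases e1 with ⟨h1, h2⟩ | ⟨h1, h2⟩ <;> rcases e2 with ⟨h3, h4⟩ | ⟨h3, h4⟩ <;>
        rw [h1, h2, h3, h4] <;> simp
    rcases key with ⟨h1, h2⟩ | ⟨h1, h2⟩
    · have := hinj _ (hlt _) _ (hlt _) h1
      rw [hmod _ (by omega), hmod _ (by omega)] at this
      split_ifs at this <;> omega
    · have h3 := hinj _ (hlt _) _ (hlt _) h1
      have h4 := hinj _ (hlt _) _ (hlt _) h2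
      rw [hmod _ (by omega), hmod _ (by omega)] at h3 h4
      split_ifs at h3 h4 <;> omega
  have hend : (a + 1 + (m - 1)) % m = a % m := by
    rw [show a + 1 + (m - 1) = a + m by omega, Nat.add_mod_right]
  rcases hedge _ hna with ⟨h1, h2⟩ | ⟨h1, h2⟩
  · refine huv (fun j => f ((a + 1 + (m - 1 - j)) % m)) (m - 1) (by omega) ?_ ?_ ?_
    · simp [hend, h1]
    · simpa using h2
    · intro i hi
      have := (hpath (m - 1 - (i + 1)) (by omega)).symm
      rwa [show m - 1 - (i + 1) + 1 = m - 1 - i by omega] at this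
  · refine huv (fun j => f ((a + 1 + j) % m)) (m - 1) (by omega) ?_ ?_ ?_
    · simpa using h2
    · simp [hend, h1]
    · exact hpath

/-- In a graph of maximum degree at most `t`, few vertices are within distance `n` of `u`. -/
theorem exists_finset_ball {G : SimpleGraph V} [Fintype V] [DecidableEq V] [DecidableRel G.Adj]
    {t : ℕ} (ht : ∀ v, (univ.filter (G.Adj v)).card ≤ t) (u : V) (n : ℕ) :
    ∃ B : Finset V, B.card ≤ (t + 1) ^ n ∧ ∀ (g : ℕ → V) (k : ℕ), k ≤ n → g 0 = u →
      (∀ i < k, G.Adj (g i) (g (i + 1))) → g k ∈ B := by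
  induction n with
  | zero =>
    refine ⟨{u}, by simp, ?_⟩
    intro g k hk h0 _
    obtain rfl : k = 0 := by omega
    simp [h0]
  | succ n ih =>
    obtain ⟨B, hB, hmem⟩ := ih
    refine ⟨B ∪ B.biUnion fun v => univ.filter (G.Adj v), ?_, ?_⟩
    · calc _ ≤ B.card + (B.biUnion fun v => univ.filter (G.Adj v)).card := card_union_le _ _
        _ ≤ B.card + B.card * t := by gcongr; exact card_biUnion_le_card_mul _ _ _ fun v _ => ht v
        _ = B.card * (t + 1) := by ring
        _ ≤ (t + 1) ^ n * (t + 1) := by gcongr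
        _ = (t + 1) ^ (n + 1) := by ring
    · intro g k hk h0 hadj
      by_cases hkn : k ≤ n
      · exact mem_union_left _ (hmem g k hkn h0 hadj)
      · obtain rfl : k = n + 1 := by omega
        refine mem_union_right _ (mem_biUnion.2 ⟨g n, ?_, ?_⟩)
        · exact hmem g n le_rfl h0 fun i hi => hadj i (by omega)
        · simpa using hadj n (by omega)

theorem free_cycleGraph_bot {m : ℕ} (hm : 3 ≤ m) : (cycleGraph m).Free (⊥ : SimpleGraph V) := by
  intro h
  obtain ⟨f, -, h, -⟩ := (cycleGraph_isContained_iff_exists_nat hm).1 h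
  simpa using h 0 (by omega)

/-- A graph of maximum degree at most `Δ` is the quotient of a graph without cycles of length at
most `L` whose fibres are much smaller than `Δ`. -/
theorem exists_cover_free_cycleGraph {I : Type*} [Fintype I] [DecidableEq I] (M : SimpleGraph I)
    [DecidableRel M.Adj] {Δ t s L : ℕ} (hM : ∀ i, (univ.filter (M.Adj i)).card ≤ Δ) (ht : 0 < t)
    (hs : Δ / t + (t + 1) ^ L < s) :
    ∃ H : SimpleGraph (I × Fin s), (∀ m, 3 ≤ m → m ≤ L → (cycleGraph m).Free H) ∧
      ∀ i j, M.Adj i j → ∃ a b, H.Adj (i, a) (j, b) := by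
  classical
  -- A maximal partial lift is taken: no short cycles, edges lying over edges of `M`, at most one
  -- over each of them, degrees at most `t`. If an edge ij of `M` had no lift, one could be added.
  let F : Set (SimpleGraph (I × Fin s)) := {H | (∀ m, 3 ≤ m → m ≤ L → (cycleGraph m).Free H) ∧
    (∀ x y, H.Adj x y → M.Adj x.1 y.1) ∧
    (∀ x y x' y', H.Adj x y → H.Adj x' y' → x.1 = x'.1 → y.1 = y'.1 → x = x') ∧
    ∀ x, (univ.filter (H.Adj x)).card ≤ t}
  have hF : (⊥ : SimpleGraph (I × Fin s)) ∈ F :=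
    ⟨fun m hm _ => free_cycleGraph_bot hm, by simp, by simp, by simp⟩
  obtain ⟨H, hH, hmax⟩ := (Set.toFinite F).exists_maximal ⟨_, hF⟩
  obtain ⟨hfree, hlift, hinj, hdeg⟩ := hH
  refine ⟨H, hfree, ?_⟩
  intro i j hij
  by_contra! hno
  -- Distinct edges at the fibre over `i` lie over distinct edges of `M` at `i`, so at most Δ / t
  -- vertices of the fibre are saturated.
  have hfull : ∀ i, (univ.filter fun a : Fin s => t ≤ (univ.filter (H.Adj (i, a))).card).card
      ≤ Δ / t := by
    intro i
    rw [Nat.le_div_iff_mul_le ht]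
    calc _ ≤ ∑ a ∈ univ.filter (fun a : Fin s => t ≤ (univ.filter (H.Adj (i, a))).card),
          (univ.filter (H.Adj (i, a))).card :=
          card_nsmul_le_sum _ _ _ fun a ha => (mem_filter.1 ha).2
      _ ≤ ∑ a : Fin s, (univ.filter (H.Adj (i, a))).card :=
          sum_le_sum_of_subset (filter_subset _ _)
      _ = (univ.sigma fun a : Fin s => univ.filter (H.Adj (i, a))).card := (card_sigma _ _).symm
      _ ≤ (univ.filter (M.Adj i)).card := by
          refine card_le_card_of_injOn (fun x => x.2.1) ?_ ?_
          · rintro ⟨a, y⟩ h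
            simp only [coe_sigma, Set.mem_sigma_iff, coe_filter, mem_univ, true_and,
              Set.mem_ofPred_eq] at h
            simpa using hlift _ _ h.2
          · rintro ⟨a, y⟩ h ⟨b, z⟩ h' heq
            simp only [coe_sigma, Set.mem_sigma_iff, coe_filter, mem_univ, true_and,
              Set.mem_ofPred_eq] at h h' heq
            have h1 := hinj _ _ _ _ h.2 h'.2 rfl heq
            have h2 := hinj _ _ _ _ h.2.symm h'.2.symm heq rfl
            simp only [Prod.mk.injEq, true_and] at h1
            rw [h1, h2]
      _ ≤ Δ := hM i
  have hpos : 0 < (t + 1) ^ L := by positivity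
  obtain ⟨a, ha⟩ : ∃ a : Fin s, (univ.filter (H.Adj (i, a))).card < t := by
    by_contra! hcon
    have := hfull i
    rw [filter_true_of_mem fun a _ => hcon a, card_univ, Fintype.card_fin] at this
    omega
  obtain ⟨B, hB, hball⟩ := exists_finset_ball hdeg (i, a) L
  -- The fibre has more than Δ / t + (t + 1)^L vertices, so one of them is neither saturated nor
  -- within distance `L` of `(i, a)`.
  obtain ⟨b, hb, hbB⟩ : ∃ b : Fin s, (univ.filter (H.Adj (j, b))).card < t ∧ (j, b) ∉ B := by
    by_contra! hcon
    have hsub : (univ : Finset (Fin s)) ⊆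
        (univ.filter fun b : Fin s => t ≤ (univ.filter (H.Adj (j, b))).card) ∪
          univ.filter fun b => (j, b) ∈ B := by
      intro b _
      by_cases hb : t ≤ (univ.filter (H.Adj (j, b))).card
      · simp [hb]
      · have := hcon b (by omega)
        simp [this]
    have h1 := (card_le_card hsub).trans (card_union_le _ _)
    have h2 : (univ.filter fun b : Fin s => (j, b) ∈ B).card ≤ B.card :=
      card_le_card_of_injOn (fun b => (j, b)) (by intro b; simp) (by intro b _ c _; simp)
    have := hfull j
    rw [card_univ, Fintype.card_fin] at h1
    omega
  have huv : ((i, a) : I × Fin s) ≠ (j, b) := fun h => hij.ne (congrArg Prod.fst h)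
  have hadj' : ∀ x y, (H ⊔ edge (i, a) (j, b)).Adj x y → H.Adj x y ∨
      (x = (i, a) ∧ y = (j, b)) ∨ (x = (j, b) ∧ y = (i, a)) := by
    intro x y h
    rw [sup_adj, edge_adj] at h
    exact h.imp id fun h => h.1
  have hmem : H ⊔ edge (i, a) (j, b) ∈ F := by
    refine ⟨?_, ?_, ?_, ?_⟩
    · refine free_cycleGraph_sup_edge hfree ?_
      intro g k hk h0 hgk hg
      exact hbB (hgk ▸ hball g k hk.le h0 hg)
    · intro x y h
      rcases hadj' x y h with h | ⟨rfl, rfl⟩ | ⟨rfl, rfl⟩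
      · exact hlift _ _ h
      · exact hij
      · exact hij.symm
    · intro x y x' y' h h' hx hy
      rcases hadj' x y h with k | ⟨rfl, rfl⟩ | ⟨rfl, rfl⟩ <;>
        rcases hadj' x' y' h' with k' | ⟨rfl, rfl⟩ | ⟨rfl, rfl⟩
      · exact hinj _ _ _ _ k k' hx hy
      · obtain ⟨x1, x2⟩ := x
        obtain ⟨y1, y2⟩ := y
        simp only at hx hy
        subst hx hy
        exact absurd k (hno _ _)
      · obtain ⟨x1, x2⟩ := x
        obtain ⟨y1, y2⟩ := y
        simp only at hx hy
        subst hx hy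
        exact absurd k.symm (hno _ _)
      · obtain ⟨x1, x2⟩ := x'
        obtain ⟨y1, y2⟩ := y'
        simp only at hx hy
        subst hx hy
        exact absurd k' (hno _ _)
      · rfl
      · exact absurd hx hij.ne
      · obtain ⟨x1, x2⟩ := x'
        obtain ⟨y1, y2⟩ := y'
        simp only at hx hy
        subst hx hy
        exact absurd k'.symm (hno _ _)
      · exact absurd hx.symm hij.ne
      · rfl
    · intro x
      have hsubset : (univ.filter ((H ⊔ edge (i, a) (j, b)).Adj x)) ⊆
          if x = (i, a) then insert (j, b) (univ.filter (H.Adj x)) else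
            if x = (j, b) then insert (i, a) (univ.filter (H.Adj x)) else
              univ.filter (H.Adj x) := by
        intro y hy
        have hy := hadj' x y (mem_filter.1 hy).2
        split_ifs with h1 h2
        · subst h1
          rcases hy with h | ⟨-, rfl⟩ | ⟨h, rfl⟩
          · simp [h]
          · simp
          · exact absurd h huv
        · subst h2
          rcases hy with h | ⟨h, rfl⟩ | ⟨h, rfl⟩
          · simp [h]
          · exact absurd h huv.symm
          · simp
        · rcases hy with h | ⟨h, rfl⟩ | ⟨h, rfl⟩
          · simp [h]
          · exact absurd h h1
          · exact absurd h h2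
      have hcard := card_le_card hsubset
      refine (le_of_eq (by congr)).trans (hcard.trans ?_)
      split_ifs with h1 h2
      · subst h1
        exact (card_insert_le _ _).trans ha
      · subst h2
        exact (card_insert_le _ _).trans hb
      · exact hdeg x
  have hle := hmax hmem le_sup_left
  refine hno a b (hle ?_)
  rw [sup_adj, edge_adj]
  exact Or.inr ⟨Or.inl ⟨rfl, rfl⟩, huv⟩

end SimpleGraph

/-! ### Repairing the missing pairs of parts -/

namespace CompletePartition

open Finset SimpleGraph

/-- If every part sees all but at most `Δ` of the others, then the missing edges can be supplied at
the cost of `s` further vertices in each part. -/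
theorem exists_isRKGraph_of_few_missing {V I : Type*} [Fintype V] [DecidableEq V] [Fintype I] [DecidableEq I]
    {G : SimpleGraph V} [DecidableRel G.Adj] {𝓗 : Family} {L : ℕ}
    (h𝓗 : ∀ H ∈ 𝓗, ∃ m, 3 ≤ m ∧ m ≤ L ∧ H = C m)
    (hG : FamilyFree 𝓗 G) (P : I → Finset V) {k Δ t s : ℕ}
    (hdisj : ∀ i j, i ≠ j → Disjoint (P i) (P j)) (hne : ∀ i, (P i).Nonempty)
    (hcard : ∀ i, (P i).card ≤ k)
    (hmiss : ∀ i, (univ.filter fun j => i ≠ j ∧ ∀ a ∈ P i, ∀ b ∈ P j, ¬ G.Adj a b).card ≤ Δ)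
    (ht : 0 < t) (hs : Δ / t + (t + 1) ^ L < s) :
    ∃ (n : ℕ) (G' : SimpleGraph (Fin n)), FamilyFree 𝓗 G' ∧ IsRKGraph G' (Fintype.card I) (k + s) := by
  classical
  -- `M` joins the pairs of parts without an edge. Its lift `H` is placed disjointly beside `G`, and
  -- the fibre over `i` is added to the part `P i`.
  let M : SimpleGraph I :=
    { Adj := fun i j => i ≠ j ∧ ∀ a ∈ P i, ∀ b ∈ P j, ¬ G.Adj a b
      symm := ⟨fun i j h => ⟨h.1.symm, fun a ha b hb hab => h.2 b hb a ha hab.symm⟩⟩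
      loopless := ⟨fun i h => h.1 rfl⟩ }
  obtain ⟨H, hHfree, hH⟩ := exists_cover_free_cycleGraph M (Δ := Δ)
    (fun i => le_trans (le_of_eq (by congr)) (hmiss i)) ht hs
  let Q : I → Finset (V ⊕ (I × Fin s)) := fun i =>
    (P i).disjSum ({i} ×ˢ univ)
  refine exists_isRKGraph_of_disjoint_parts (G := G ⊕g H) ?_ Q ?_ ?_ ?_ ?_
  · intro A hA
    obtain ⟨m, h3, hmL, rfl⟩ := h𝓗 A hA
    exact free_sum_cycleGraph h3 (hG _ hA) (hHfree m h3 hmL)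
  · intro i j hij
    rw [Finset.disjoint_left]
    rintro (x | ⟨x, a⟩) h h'
    · simp only [Q, inl_mem_disjSum] at h h'
      exact Finset.disjoint_left.1 (hdisj i j hij) h h'
    · simp [Q] at h h'
      exact hij (h.trans h'.symm)
  · intro i
    obtain ⟨v, hv⟩ := hne i
    exact ⟨Sum.inl v, by simpa [Q] using hv⟩
  · intro i
    simp only [Q, card_disjSum, card_product, card_singleton, one_mul, card_univ, Fintype.card_fin]
    have := hcard i
    omega
  · intro i j hij
    by_cases hM : M.Adj i j
    · obtain ⟨a, b, hab⟩ := hH i j hM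
      exact ⟨Sum.inr (i, a), by simp [Q], Sum.inr (j, b), by simp [Q], by simpa using hab⟩
    · simp only [M, not_and, not_forall, not_not] at hM
      obtain ⟨a, ha, b, hb, hab⟩ := hM hij
      exact ⟨Sum.inl a, by simpa [Q] using ha, Sum.inl b, by simpa [Q] using hb,
        by simpa using hab⟩

end CompletePartition

/-! ### A lower bound for the number of good walks -/

namespace SimpleGraph

open Finset

variable {V : Type*} [Fintype V] (G : SimpleGraph V) (good : V → V → V → Prop)

/-- `G.steps good j u v` is the number of ways to continue the step from `u` to `v` by `j` further
steps in such a way that any three consecutive vertices form a good triple. -/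
noncomputable def steps : ℕ → V → V → ℝ
  | 0, _, _ => 1
  | j + 1, u, v => by
      classical exact ∑ w, if G.Adj v w ∧ good u v w then steps j v w else 0

open Classical in
/-- The sum of `g` over all ordered pairs of adjacent vertices. -/
noncomputable def dartSum (g : V → V → ℝ) : ℝ := ∑ u, ∑ v, if G.Adj u v then g u v else 0

open Classical in
/-- The mean of `g` over the edges out of `v`, where edges which are not a good continuation of the
step from `u` to `v` count as `0`. -/
noncomputable def goodMean (g : V → V → ℝ) (u v : V) : ℝ :=
  (∑ w, if G.Adj v w ∧ good u v w then g v w else 0) / (univ.filter (G.Adj v)).card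

variable {G good}

open Classical in
theorem card_filter_adj_pos {u v : V} (h : G.Adj u v) :
    (0 : ℝ) < (univ.filter (G.Adj v)).card := by
  exact_mod_cast card_pos.2 ⟨u, by simpa using h.symm⟩

theorem dartSum_mono {g g' : V → V → ℝ} (h : ∀ u v, G.Adj u v → g u v ≤ g' u v) :
    G.dartSum g ≤ G.dartSum g' := by
  refine sum_le_sum fun u _ => sum_le_sum fun v _ => ?_
  split_ifs with huv
  · exact h u v huv
  · exact le_rfl

theorem dartSum_add (g g' : V → V → ℝ) :
    G.dartSum (fun u v => g u v + g' u v) = G.dartSum g + G.dartSum g' := by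
  simp only [dartSum, ← sum_add_distrib]
  refine sum_congr rfl fun u _ => sum_congr rfl fun v _ => ?_
  split_ifs <;> simp

theorem dartSum_mul_left (c : ℝ) (g : V → V → ℝ) :
    G.dartSum (fun u v => c * g u v) = c * G.dartSum g := by
  simp only [dartSum, mul_sum]
  refine sum_congr rfl fun u _ => sum_congr rfl fun v _ => ?_
  split_ifs <;> simp

theorem goodMean_mono {g g' : V → V → ℝ} (h : ∀ u v, G.Adj u v → g u v ≤ g' u v) (u v : V) :
    G.goodMean good g u v ≤ G.goodMean good g' u v := by
  unfold goodMean
  gcongr with w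
  split_ifs with hw
  · exact h _ _ hw.1
  · exact le_rfl

theorem goodMean_add (g g' : V → V → ℝ) (u v : V) :
    G.goodMean good (fun u v => g u v + g' u v) u v =
      G.goodMean good g u v + G.goodMean good g' u v := by
  simp only [goodMean, ← add_div, ← sum_add_distrib]
  congr 1
  refine sum_congr rfl fun w _ => ?_
  split_ifs <;> simp

theorem goodMean_mul_left (c : ℝ) (g : V → V → ℝ) (u v : V) :
    G.goodMean good (fun u v => c * g u v) u v = c * G.goodMean good g u v := by
  simp only [goodMean, mul_div_assoc', mul_sum]
  congr 1
  refine sum_congr rfl fun w _ => ?_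
  split_ifs <;> simp

theorem goodMean_nonneg {g : V → V → ℝ} (h : ∀ u v, G.Adj u v → 0 ≤ g u v) (u v : V) :
    0 ≤ G.goodMean good g u v := by
  refine div_nonneg (sum_nonneg fun w _ => ?_) (by positivity)
  split_ifs with hw
  · exact h _ _ hw.1
  · exact le_rfl

theorem goodMean_one_le (u v : V) : G.goodMean good (fun _ _ => 1) u v ≤ 1 := by
  classical
  refine div_le_one_of_le₀ ?_ (by positivity)
  rw [card_eq_sum_ones, sum_filter, Nat.cast_sum]
  refine sum_le_sum fun w _ => ?_
  by_cases hw : G.Adj v w <;> by_cases hg : good u v w <;> simp [hw, hg]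

/-- Averaging over good continuations does not increase the total of a nonnegative function. -/
theorem dartSum_goodMean_le {g : V → V → ℝ} (h : ∀ u v, G.Adj u v → 0 ≤ g u v) :
    G.dartSum (G.goodMean good g) ≤ G.dartSum g := by
  classical
  unfold dartSum
  rw [sum_comm]
  refine sum_le_sum fun v _ => ?_
  set S := ∑ w, if G.Adj v w then g v w else 0 with hS
  have hS0 : 0 ≤ S := sum_nonneg fun w _ => by
    split_ifs with hw
    · exact h _ _ hw
    · exact le_rfl
  calc ∑ u, (if G.Adj u v then G.goodMean good g u v else 0)
      ≤ ∑ u, if G.Adj v u then S / (univ.filter (G.Adj v)).card else 0 := by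
        refine sum_le_sum fun u _ => ?_
        rw [G.adj_comm u v]
        split_ifs with hu
        · unfold goodMean
          rw [hS]
          gcongr with w
          by_cases hw : G.Adj v w <;> by_cases hg : good u v w <;> simp [hw, hg]
          exact h _ _ hw
        · exact le_rfl
    _ = (univ.filter (G.Adj v)).card * (S / (univ.filter (G.Adj v)).card) := by
        rw [← sum_filter, sum_const, nsmul_eq_mul]
    _ ≤ S := by
        rcases (Nat.cast_nonneg (α := ℝ) (univ.filter (G.Adj v)).card).eq_or_lt with h0 | h0
        · rw [← h0]; simpa using hS0
        · rw [mul_div_cancel₀ _ h0.ne']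

variable (G good) in
/-- The probability that the random walk which picks uniform continuations survives `j` steps
through good triples only. -/
noncomputable def survival : ℕ → V → V → ℝ
  | 0 => fun _ _ => 1
  | j + 1 => G.goodMean good (survival j)

open Classical in
variable (G good) in
/-- The expected sum of `D / deg` over the interior vertices of the surviving random walks. -/
noncomputable def invDegSum (D : ℝ) : ℕ → V → V → ℝ
  | 0 => fun _ _ => 0
  | j + 1 => fun u v => D / (univ.filter (G.Adj v)).card * survival G good (j + 1) u v +
      G.goodMean good (invDegSum D j) u v

theorem survival_nonneg (j : ℕ) (u v : V) : 0 ≤ survival G good j u v := by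
  induction j generalizing u v with
  | zero => exact zero_le_one
  | succ j ih => exact goodMean_nonneg (fun u v _ => ih u v) u v

theorem survival_le_one (j : ℕ) (u v : V) : survival G good j u v ≤ 1 := by
  induction j generalizing u v with
  | zero => exact le_rfl
  | succ j ih => exact (goodMean_mono (fun u v _ => ih u v) u v).trans (goodMean_one_le u v)

theorem invDegSum_nonneg {D : ℝ} (hD : 0 ≤ D) (j : ℕ) (u v : V) :
    0 ≤ invDegSum G good D j u v := by
  induction j generalizing u v with
  | zero => exact le_rfl
  | succ j ih =>
    have := survival_nonneg (G := G) (good := good) (j + 1) u v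
    have := goodMean_nonneg (G := G) (good := good) (fun u v _ => ih u v) u v
    simp only [invDegSum]
    positivity

/-- The number of good continuations is bounded below by Jensen's inequality for `log`. -/
theorem le_mul_steps {D : ℝ} (hD : 0 < D) (j : ℕ) {u v : V} (huv : G.Adj u v) {c : ℝ}
    (hc : 0 < c) :
    (1 + j + Real.log c) * survival G good j u v - invDegSum G good D j u v ≤
      c * (G.steps good j u v / D ^ j) := by
  classical
  induction j generalizing u v c with
  | zero =>
    -- The tangent 1 + log c ≤ c stands in for Jensen. Here `c` accumulates the product of deg / D
    -- along the walk, hence it is generalised in the induction.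
    have := Real.log_le_sub_one_of_pos hc
    simp only [survival, invDegSum, steps]
    norm_num
    linarith
  | succ j ih =>
    have hd := card_filter_adj_pos huv
    set d : ℝ := ((univ.filter (G.Adj v)).card : ℝ) with hd'
    -- This is 1 - D/d ≤ log (d/D): the 1 raises `j` to `j + 1`, and D/d is the new term of
    -- `invDegSum`.
    have hlog := Real.one_sub_inv_le_log_of_pos (div_pos hd hD)
    rw [inv_div] at hlog
    have hstep : c * (G.steps good (j + 1) u v / D ^ (j + 1)) =
        G.goodMean good (fun u v => (c * (d / D)) * (G.steps good j u v / D ^ j)) u v := by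
      have : G.goodMean good (fun u v => (c * (d / D) / D ^ j) * G.steps good j u v) u v =
          (c * (d / D) / D ^ j) * (G.steps good (j + 1) u v / d) := by
        rw [goodMean_mul_left]
        simp only [goodMean, steps, hd']
      rw [show (fun u v => (c * (d / D)) * (G.steps good j u v / D ^ j)) =
        fun u v => (c * (d / D) / D ^ j) * G.steps good j u v by ext; ring, this]
      field_simp
      ring
    rw [hstep]
    refine le_trans ?_ (goodMean_mono (fun u v h => ih h (by positivity)) u v)
    have hsplit : G.goodMean good (fun u v => (1 + j + Real.log (c * (d / D))) *
        survival G good j u v - invDegSum G good D j u v) u v =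
        (1 + j + Real.log (c * (d / D))) * survival G good (j + 1) u v -
          G.goodMean good (invDegSum G good D j) u v := by
      rw [show (fun u v => (1 + j + Real.log (c * (d / D))) *
        survival G good j u v - invDegSum G good D j u v) =
        fun u v => (1 + j + Real.log (c * (d / D))) *
        survival G good j u v + (-1) * invDegSum G good D j u v by ext; ring,
        goodMean_add, goodMean_mul_left, goodMean_mul_left]
      simp only [survival]
      ring
    rw [hsplit, Real.log_mul hc.ne' (by positivity)]
    simp only [invDegSum]
    rw [← hd']
    have hs := survival_nonneg (G := G) (good := good) (j + 1) u v
    have := mul_le_mul_of_nonneg_right hlog hs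
    push_cast
    nlinarith

/-- A vertex of positive degree d is the head of d darts of weight c / d, which contribute c
altogether; an isolated vertex contributes nothing. -/
theorem dartSum_inv_deg_le (c : ℝ) (hc : 0 ≤ c) [DecidableRel G.Adj] :
    G.dartSum (fun _ v => c / (univ.filter (G.Adj v)).card) ≤ c * Fintype.card V := by
  classical
  unfold dartSum
  rw [sum_comm, ← nsmul_eq_mul', ← card_univ]
  refine sum_le_card_nsmul _ _ _ fun v _ => ?_
  calc _ = ∑ u, if G.Adj v u then c / (univ.filter (G.Adj v)).card else 0 := by
        simp only [G.adj_comm v]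
    _ = (univ.filter (G.Adj v)).card * (c / (univ.filter (G.Adj v)).card) := by
        rw [← sum_filter, sum_const, nsmul_eq_mul]
    _ ≤ c := by
        rcases (Nat.cast_nonneg (α := ℝ) (univ.filter (G.Adj v)).card).eq_or_lt with h0 | h0
        · rw [← h0]; simpa using hc
        · rw [mul_div_cancel₀ _ h0.ne']

/-- Each of the `j` steps adds at most D times the number of vertices, by `dartSum_inv_deg_le`, and
`goodMean` does not increase what has accumulated. -/
theorem dartSum_invDegSum_le {D : ℝ} (hD : 0 ≤ D) (j : ℕ) :
    G.dartSum (invDegSum G good D j) ≤ j * (D * Fintype.card V) := by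
  classical
  induction j with
  | zero => simp [invDegSum, dartSum]
  | succ j ih =>
    simp only [invDegSum]
    rw [dartSum_add]
    have h1 := dartSum_goodMean_le (G := G) (good := good)
      (fun u v _ => invDegSum_nonneg (G := G) (good := good) hD j u v)
    have h2 : G.dartSum (fun u v => D / (univ.filter (G.Adj v)).card *
        survival G good (j + 1) u v) ≤ D * Fintype.card V := by
      refine le_trans (dartSum_mono fun u v _ => ?_) (dartSum_inv_deg_le (G := G) D hD)
      exact mul_le_of_le_one_right (by positivity) (survival_le_one _ _ _)
    push_cast
    linarith

open Classical in
-- A walk dies at `v` with probability at most b / deg v, which sums over the darts to at most b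
-- times the number of vertices. The earlier loss 1 - `survival` is carried along by `goodMean`,
-- whose total does not grow.
theorem dartSum_survival_ge {b : ℕ} (hbad : ∀ u v, G.Adj u v →
      (univ.filter fun w => G.Adj v w ∧ ¬ good u v w).card ≤ b) (j : ℕ) :
    G.dartSum (fun _ _ => 1) - j * (b * Fintype.card V) ≤ G.dartSum (survival G good j) := by
  induction j with
  | zero => simp [survival]
  | succ j ih =>
    have hle : ∀ u v, G.Adj u v → 0 ≤ 1 + (-1) * survival G good j u v := fun u v _ => by
      have := survival_le_one (G := G) (good := good) j u v
      linarith
    have h1 := dartSum_goodMean_le (G := G) (good := good) hle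
    have h2 : G.dartSum (fun u v => 1 + (-1) * survival G good (j + 1) u v) ≤
        G.dartSum (fun u v => (b : ℝ) / (univ.filter (G.Adj v)).card +
          G.goodMean good (fun u v => 1 + (-1) * survival G good j u v) u v) := by
      refine dartSum_mono fun u v huv => ?_
      rw [goodMean_add, goodMean_mul_left]
      have hd := card_filter_adj_pos huv
      have h3 : 1 - (b : ℝ) / (univ.filter (G.Adj v)).card ≤
          G.goodMean good (fun _ _ => 1) u v := by
        unfold goodMean
        rw [one_sub_div hd.ne', div_le_div_iff_of_pos_right hd, sub_le_iff_le_add,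
          ← sum_filter, sum_const, nsmul_eq_mul, mul_one]
        have h4 : (univ.filter (G.Adj v)).card =
            (univ.filter fun w => G.Adj v w ∧ good u v w).card +
              (univ.filter fun w => G.Adj v w ∧ ¬ good u v w).card := by
          rw [← card_filter_add_card_filter_not (s := univ.filter (G.Adj v)) (good u v),
            filter_filter, filter_filter]
        rw [h4]
        have := hbad u v huv
        exact_mod_cast Nat.add_le_add_left this _
      simp only [survival]
      linarith
    rw [dartSum_add] at h2
    rw [dartSum_add, dartSum_mul_left] at h1
    rw [dartSum_add, dartSum_mul_left] at h2
    have h5 := dartSum_inv_deg_le (G := G) (b : ℝ) (by positivity)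
    have h6 : G.dartSum (fun u v => G.goodMean good
      (fun u v => 1 + (-1) * survival G good j u v) u v) ≤
      G.dartSum (fun _ _ => 1) + -1 * G.dartSum (survival G good j) := h1
    push_cast
    linarith

open Classical in
/-- A graph of average degree `D` in which each step has at most `b` bad continuations has
about as many good walks as a regular graph. -/
theorem le_dartSum_steps {b : ℕ} (hbad : ∀ u v, G.Adj u v →
      (univ.filter fun w => G.Adj v w ∧ ¬ good u v w).card ≤ b) (j : ℕ) {D : ℝ} (hD : 0 < D)
    (hDn : G.dartSum (fun _ _ => 1) = D * Fintype.card V) :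
    D ^ j * ((D - j * (j + 1) * b) * Fintype.card V) ≤ G.dartSum (G.steps good j) := by
  -- `le_mul_steps` with c = 1, summed over the darts. With n vertices the bounds combine to (1 +
  -- j)(Dn - jbn) - jDn = (D - j(j + 1)b)n.
  have h1 : G.dartSum (fun u v => (1 + j) * survival G good j u v +
      (-1) * invDegSum G good D j u v) ≤
      G.dartSum (fun u v => (D ^ j)⁻¹ * G.steps good j u v) := by
    refine dartSum_mono fun u v huv => ?_
    have := le_mul_steps (G := G) (good := good) hD j huv one_pos
    rw [Real.log_one] at this
    rw [inv_mul_eq_div]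
    linarith
  rw [dartSum_add, dartSum_mul_left, dartSum_mul_left, dartSum_mul_left] at h1
  have h2 := dartSum_survival_ge hbad j
  have h3 := dartSum_invDegSum_le (G := G) (good := good) hD.le j
  rw [hDn] at h2
  rw [inv_mul_eq_div, le_div_iff₀ (by positivity), mul_comm] at h1
  refine le_trans ?_ h1
  have hj : (0 : ℝ) ≤ 1 + j := by positivity
  have := mul_le_mul_of_nonneg_left h2 hj
  gcongr
  linarith

end SimpleGraph

/-! ### Good walks in graphs without short even cycles -/

namespace SimpleGraph

open Finset

variable {V : Type*}

theorem Free.false_of_cycle_six {G : SimpleGraph V} (hG : (cycleGraph 6).Free G)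
    {a b c d e f : V} (h1 : G.Adj a b) (h2 : G.Adj b c) (h3 : G.Adj c d) (h4 : G.Adj d e)
    (h5 : G.Adj e f) (h6 : G.Adj f a) (h : [a, b, c, d, e, f].Nodup) : False :=
  hG.not_adj_getLast a [b, c, d, e, f] h (by norm_num) rfl (by simp [*]) h6

theorem Free.false_of_cycle_eight {G : SimpleGraph V} (hG : (cycleGraph 8).Free G)
    {a b c d e f g h : V} (h1 : G.Adj a b) (h2 : G.Adj b c) (h3 : G.Adj c d) (h4 : G.Adj d e)
    (h5 : G.Adj e f) (h6 : G.Adj f g) (h7 : G.Adj g h) (h8 : G.Adj h a)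
    (hn : [a, b, c, d, e, f, g, h].Nodup) : False :=
  hG.not_adj_getLast a [b, c, d, e, f, g, h] hn (by norm_num) rfl (by simp [*]) h8

theorem Free.false_of_cycle_ten {G : SimpleGraph V} (hG : (cycleGraph 10).Free G)
    {a b c d e f g h i j : V} (h1 : G.Adj a b) (h2 : G.Adj b c) (h3 : G.Adj c d) (h4 : G.Adj d e)
    (h5 : G.Adj e f) (h6 : G.Adj f g) (h7 : G.Adj g h) (h8 : G.Adj h i) (h9 : G.Adj i j)
    (h10 : G.Adj j a) (hn : [a, b, c, d, e, f, g, h, i, j].Nodup) : False :=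
  hG.not_adj_getLast a [b, c, d, e, f, g, h, i, j] hn (by norm_num) rfl (by simp [*]) h10

/-- Three vertices which are distinct and do not lie on a common triangle. -/
def NoTriangle (G : SimpleGraph V) (u _v w : V) : Prop := u ≠ w ∧ ¬ G.Adj u w

/-- Three vertices which are distinct and do not lie consecutively on a triangle or pentagon. -/
def NoPentagon (G : SimpleGraph V) (u v w : V) : Prop :=
  u ≠ w ∧ ¬ G.Adj u w ∧ ∀ s t, G.Adj w s → G.Adj s t → G.Adj t u → [u, v, w, s, t].Nodup → False

theorem Free.eq_of_adj_adj {G : SimpleGraph V} (h4 : (cycleGraph 4).Free G) {x y a b : V}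
    (hxy : x ≠ y) (h1 : G.Adj x a) (h2 : G.Adj a y) (h3 : G.Adj x b) (h4' : G.Adj b y) :
    a = b := by
  by_contra hab
  exact h4.false_of_cycle_four h1 h2 h4'.symm h3.symm hxy hab

open Classical in
-- A bad continuation is `u` itself or a common neighbour of `u` and `v`, and two common neighbours
-- would give a 4-cycle.
theorem Free.card_filter_not_noTriangle_le [Fintype V] {G : SimpleGraph V}
    (h4 : (cycleGraph 4).Free G) {u v : V} (huv : G.Adj u v) :
    (univ.filter fun w => G.Adj v w ∧ ¬ G.NoTriangle u v w).card ≤ 2 := by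
  have hsub : (univ.filter fun w => G.Adj v w ∧ ¬ G.NoTriangle u v w) ⊆
      insert u (univ.filter fun w => G.Adj v w ∧ G.Adj u w) := by
    intro w hw
    have hw := (mem_filter.1 hw).2
    simp only [mem_filter, mem_univ, true_and, mem_insert]
    by_cases h : w = u
    · exact Or.inl h
    · right
      refine ⟨hw.1, ?_⟩
      by_contra hn
      exact hw.2 ⟨Ne.symm h, hn⟩
  refine (card_le_card hsub).trans ((card_insert_le _ _).trans (Nat.succ_le_succ ?_))
  rw [card_le_one]
  intro a ha b hb
  simp only [mem_filter, mem_univ, true_and] at ha hb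
  exact h4.eq_of_adj_adj huv.ne ha.2 ha.1.symm hb.2 hb.1.symm

theorem ite_sum_zero {ι : Type*} [Fintype ι] (c : Prop) [Decidable c] (g : ι → ℝ) :
    (if c then ∑ i, g i else 0) = ∑ i, if c then g i else 0 := by
  split_ifs <;> simp

/-- Walks agreeing at one inner position agree at the other, for lack of 4-cycles. If they differ at
both, they close up to a 6-cycle, `NoTriangle` excluding the remaining coincidences. -/
theorem eq_of_noTriangle_walks {G : SimpleGraph V}
    (h4 : (cycleGraph 4).Free G) (h6 : (cycleGraph 6).Free G) {x a b y a' b' : V}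
    (h1 : G.Adj x a) (h2 : G.Adj a b) (h3 : G.Adj b y) (g1 : G.NoTriangle x a b)
    (g2 : G.NoTriangle a b y) (h1' : G.Adj x a') (h2' : G.Adj a' b') (h3' : G.Adj b' y)
    (g1' : G.NoTriangle x a' b') (g2' : G.NoTriangle a' b' y) : a = a' ∧ b = b' := by
  have hxy : x ≠ y := by rintro rfl; exact g1.2 h3.symm
  by_cases hab : a = a'
  · subst hab
    exact ⟨rfl, h4.eq_of_adj_adj g2.1 h2 h3 h2' h3'⟩
  by_cases hbb : b = b'
  · subst hbb
    exact ⟨h4.eq_of_adj_adj g1.1 h1 h2 h1' h2', rfl⟩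
  exfalso
  have n1 : a ≠ b' := by rintro rfl; exact g1'.2 h1
  have n2 : b ≠ a' := by rintro rfl; exact g1.2 h1'
  refine h6.false_of_cycle_six h1 h2 h3 h3'.symm h2'.symm h1'.symm ?_
  have := g1.1; have := g2.1; have := g1'.1; have := g2'.1
  have := h1.ne; have := h2.ne; have := h3.ne; have := h1'.ne; have := h2'.ne; have := h3'.ne
  simp only [List.nodup_cons, List.mem_cons, List.not_mem_nil, not_or]
  grind

open Classical in
theorem dartSum_steps_noTriangle_le [Fintype V] {G : SimpleGraph V}
    (h4 : (cycleGraph 4).Free G) (h6 : (cycleGraph 6).Free G) :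
    G.dartSum (G.steps G.NoTriangle 2) ≤ (Fintype.card V : ℝ) ^ 2 := by
  -- A dart with two further steps is a walk with three edges and four vertices.
  have hcount : G.dartSum (G.steps G.NoTriangle 2) = ((univ.filter fun p : V × V × V × V =>
      G.Adj p.1 p.2.1 ∧ (G.Adj p.2.1 p.2.2.1 ∧ G.NoTriangle p.1 p.2.1 p.2.2.1) ∧
        G.Adj p.2.2.1 p.2.2.2 ∧ G.NoTriangle p.2.1 p.2.2.1 p.2.2.2).card : ℝ) := by
    simp only [dartSum, steps, ite_sum_zero, ← ite_and, card_filter, Fintype.sum_prod_type,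
      Nat.cast_sum, Nat.cast_ite, Nat.cast_one, Nat.cast_zero]
  rw [hcount, sq, ← Nat.cast_mul, ← Fintype.card_prod, ← card_univ, Nat.cast_le]
  refine card_le_card_of_injOn (fun p => (p.1, p.2.2.2)) (by simp) ?_
  rintro ⟨x, a, b, y⟩ h ⟨x', a', b', y'⟩ h' heq
  simp only [coe_filter, mem_univ, true_and, Set.mem_ofPred_eq, Prod.mk.injEq] at h h' heq
  obtain ⟨rfl, rfl⟩ := heq
  obtain ⟨rfl, rfl⟩ := eq_of_noTriangle_walks h4 h6 h.1 h.2.1.1 h.2.2.1 h.2.1.2 h.2.2.2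
    h'.1 h'.2.1.1 h'.2.2.1 h'.2.1.2 h'.2.2.2
  rfl

/-- If w ≠ w', the pentagons on the edge uv form the 8-cycle v w s t u t' s' w', or the 6-cycle v w
s t s' w' when t = t'. Every other coincidence gives a 4-cycle. -/
theorem eq_of_pentagon_pentagon {G : SimpleGraph V} (h4 : (cycleGraph 4).Free G)
    (h6 : (cycleGraph 6).Free G) (h8 : (cycleGraph 8).Free G) {u v w s t w' s' t' : V}
    (huv : G.Adj u v) (h1 : G.Adj v w) (h2 : G.Adj w s) (h3 : G.Adj s t) (h5 : G.Adj t u)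
    (hn : [u, v, w, s, t].Nodup) (h1' : G.Adj v w') (h2' : G.Adj w' s') (h3' : G.Adj s' t')
    (h5' : G.Adj t' u) (hn' : [u, v, w', s', t'].Nodup) : w = w' := by
  by_contra hw
  simp only [List.nodup_cons, List.mem_cons, List.not_mem_nil, not_or, not_false_eq_true,
    List.nodup_nil, and_true] at hn hn'
  obtain ⟨⟨n1, n2, n3, n4⟩, ⟨n5, n6, n7⟩, ⟨n8, n9⟩, n10⟩ := hn
  obtain ⟨⟨m1, m2, m3, m4⟩, ⟨m5, m6, m7⟩, ⟨m8, m9⟩, m10⟩ := hn'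
  have hss : s ≠ s' := by
    rintro rfl
    exact h4.false_of_cycle_four h1 h2 h2'.symm h1'.symm n6 hw
  have hws : w ≠ s' := by
    rintro rfl
    exact h4.false_of_cycle_four huv h1 h3' h5' n2 m7
  have hws' : w' ≠ s := by
    rintro rfl
    exact h4.false_of_cycle_four huv h1' h3 h5 m2 n7
  have hwt : w ≠ t' := by
    rintro rfl
    exact h4.false_of_cycle_four h1' h2' h3' h1.symm m6 (Ne.symm hw)
  have hwt' : w' ≠ t := by
    rintro rfl
    exact h4.false_of_cycle_four h1 h2 h3 h1'.symm n6 hw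
  have hst : s ≠ t' := by
    rintro rfl
    exact h4.false_of_cycle_four huv h1 h2 h5' n2 n6
  have hst' : s' ≠ t := by
    rintro rfl
    exact h4.false_of_cycle_four huv h1' h2' h5 m2 m6
  by_cases htt : t = t'
  · subst htt
    refine h6.false_of_cycle_six h1 h2 h3 h3'.symm h2'.symm h1'.symm ?_
    simp only [List.nodup_cons, List.mem_cons, List.not_mem_nil, not_or]
    grind
  · refine h8.false_of_cycle_eight h1 h2 h3 h5 h5'.symm h3'.symm h2'.symm h1'.symm ?_
    simp only [List.nodup_cons, List.mem_cons, List.not_mem_nil, not_or]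
    grind

/-- If w ≠ w', replacing the edge uv of the pentagon by the detour through `w` gives a 6-cycle, or a
4-cycle arises when `w` lies on the pentagon. -/
theorem false_of_triangle_pentagon {G : SimpleGraph V} (h4 : (cycleGraph 4).Free G)
    (h6 : (cycleGraph 6).Free G) {u v w w' s' t' : V} (huv : G.Adj u v)
    (h1 : G.Adj v w) (h2 : G.Adj w u) (h1' : G.Adj v w') (h2' : G.Adj w' s') (h3' : G.Adj s' t')
    (h5' : G.Adj t' u) (hn' : [u, v, w', s', t'].Nodup) : w = w' := by
  by_contra hw
  simp only [List.nodup_cons, List.mem_cons, List.not_mem_nil, not_or, not_false_eq_true,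
    List.nodup_nil, and_true] at hn'
  obtain ⟨⟨m1, m2, m3, m4⟩, ⟨m5, m6, m7⟩, ⟨m8, m9⟩, m10⟩ := hn'
  have hws : w ≠ s' := by
    rintro rfl
    exact h4.false_of_cycle_four huv h1' h2' h2 m2 m6
  have hwt : w ≠ t' := by
    rintro rfl
    exact h4.false_of_cycle_four h1' h2' h3' h1.symm m6 (Ne.symm hw)
  refine h6.false_of_cycle_six h2.symm h1.symm h1' h2' h3' h5' ?_
  have := h1.ne; have := h2.ne
  simp only [List.nodup_cons, List.mem_cons, List.not_mem_nil, not_or]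
  grind

open Classical in
-- Besides `u`, at most one neighbour of `v` continues the edge uv along a triangle or a pentagon,
-- whichever of the two occur.
theorem card_filter_not_noPentagon_le [Fintype V] {G : SimpleGraph V}
    (h4 : (cycleGraph 4).Free G) (h6 : (cycleGraph 6).Free G) (h8 : (cycleGraph 8).Free G)
    {u v : V} (huv : G.Adj u v) :
    (univ.filter fun w => G.Adj v w ∧ ¬ G.NoPentagon u v w).card ≤ 2 := by
  have hsub : (univ.filter fun w => G.Adj v w ∧ ¬ G.NoPentagon u v w) ⊆
      insert u (univ.filter fun w => G.Adj v w ∧ (G.Adj w u ∨ ∃ s t, G.Adj w s ∧ G.Adj s t ∧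
        G.Adj t u ∧ [u, v, w, s, t].Nodup)) := by
    intro w hw
    have hw := (mem_filter.1 hw).2
    simp only [mem_filter, mem_univ, true_and, mem_insert]
    by_cases h : w = u
    · exact Or.inl h
    · right
      refine ⟨hw.1, ?_⟩
      by_contra hn
      rw [not_or] at hn
      exact hw.2 ⟨Ne.symm h, fun h => hn.1 h.symm,
        fun s t a b c d => hn.2 ⟨s, t, a, b, c, d⟩⟩
  refine (card_le_card hsub).trans ((card_insert_le _ _).trans (Nat.succ_le_succ ?_))
  rw [card_le_one]
  intro a ha b hb
  simp only [mem_filter, mem_univ, true_and] at ha hb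
  obtain ⟨ha, ha' | ⟨s, t, ha1, ha2, ha3, ha4⟩⟩ := ha <;>
    obtain ⟨hb, hb' | ⟨s', t', hb1, hb2, hb3, hb4⟩⟩ := hb
  · exact h4.eq_of_adj_adj huv.ne ha'.symm ha.symm hb'.symm hb.symm
  · exact false_of_triangle_pentagon h4 h6 huv ha ha' hb hb1 hb2 hb3 hb4
  · exact (false_of_triangle_pentagon h4 h6 huv hb hb' ha ha1 ha2 ha3 ha4).symm
  · exact eq_of_pentagon_pentagon h4 h6 h8 huv ha ha1 ha2 ha3 ha4 hb hb1 hb2 hb3 hb4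

theorem NoPentagon.noTriangle {G : SimpleGraph V} {u v w : V} (h : G.NoPentagon u v w) :
    G.NoTriangle u v w := ⟨h.1, h.2.1⟩

/-- Agreement at an inner position reduces to shorter walks; otherwise an 8-cycle appears. This
settles walks of length five which share their first or last inner vertex. -/
theorem eq_of_noPentagon_walks_four {G : SimpleGraph V}
    (h4 : (cycleGraph 4).Free G) (h6 : (cycleGraph 6).Free G) (h8 : (cycleGraph 8).Free G)
    {x a b c y a' b' c' : V}
    (h1 : G.Adj x a) (h2 : G.Adj a b) (h3 : G.Adj b c) (h5 : G.Adj c y)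
    (g1 : G.NoPentagon x a b) (g2 : G.NoPentagon a b c) (g3 : G.NoPentagon b c y)
    (h1' : G.Adj x a') (h2' : G.Adj a' b') (h3' : G.Adj b' c') (h5' : G.Adj c' y)
    (g1' : G.NoPentagon x a' b') (g2' : G.NoPentagon a' b' c') (g3' : G.NoPentagon b' c' y) :
    a = a' ∧ b = b' ∧ c = c' := by
  by_cases haa : a = a'
  · subst haa
    exact ⟨rfl, eq_of_noTriangle_walks h4 h6 h2 h3 h5 g2.noTriangle g3.noTriangle h2' h3' h5'
      g2'.noTriangle g3'.noTriangle⟩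
  by_cases hcc : c = c'
  · subst hcc
    obtain ⟨e1, e2⟩ := eq_of_noTriangle_walks h4 h6 h1 h2 h3 g1.noTriangle g2.noTriangle h1' h2'
      h3' g1'.noTriangle g2'.noTriangle
    exact ⟨e1, e2, rfl⟩
  by_cases hbb : b = b'
  · subst hbb
    exact absurd (h4.eq_of_adj_adj g1.1 h1 h2 h1' h2') haa
  exfalso
  have hxc : x ≠ c := by rintro rfl; exact g1.2.1 h3.symm
  have hxc' : x ≠ c' := by rintro rfl; exact g1'.2.1 h3'.symm
  have hay : a ≠ y := by rintro rfl; exact g2.2.1 h5.symm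
  have hay' : a' ≠ y := by rintro rfl; exact g2'.2.1 h5'.symm
  have hxy : x ≠ y := by
    rintro rfl
    exact h4.false_of_cycle_four h1 h2 h3 h5 g1.1 g2.1
  have n1 : a ≠ b' := by rintro rfl; exact g1'.2.1 h1
  have n2 : b ≠ a' := by rintro rfl; exact g1.2.1 h1'
  have n3 : b ≠ c' := by rintro rfl; exact g3.2.1 h5'
  have n4 : c ≠ b' := by rintro rfl; exact g3'.2.1 h5
  have n5 : a ≠ c' := by
    rintro rfl
    exact h4.false_of_cycle_four h1' h2' h3' h1.symm g1'.1 g2'.1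
  have n6 : a' ≠ c := by
    rintro rfl
    exact h4.false_of_cycle_four h1 h2 h3 h1'.symm g1.1 g2.1
  refine h8.false_of_cycle_eight h1 h2 h3 h5 h5'.symm h3'.symm h2'.symm h1'.symm ?_
  have := g1.1; have := g2.1; have := g3.1; have := g1'.1; have := g2'.1; have := g3'.1
  have := h1.ne; have := h2.ne; have := h3.ne; have := h5.ne
  have := h1'.ne; have := h2'.ne; have := h3'.ne; have := h5'.ne
  simp only [List.nodup_cons, List.mem_cons, List.not_mem_nil, not_or]
  grind

/-- Walks disagreeing at every inner position close up to a 10-cycle. Coincidences of vertices at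
different positions give triangles, 4-cycles or pentagons; the pentagons are the reason for
`NoPentagon`. -/
theorem eq_of_noPentagon_walks_five {G : SimpleGraph V}
    (h4 : (cycleGraph 4).Free G) (h6 : (cycleGraph 6).Free G) (h8 : (cycleGraph 8).Free G)
    (h10 : (cycleGraph 10).Free G) {x a b c d y a' b' c' d' : V}
    (h1 : G.Adj x a) (h2 : G.Adj a b) (h3 : G.Adj b c) (h5 : G.Adj c d) (h7 : G.Adj d y)
    (g1 : G.NoPentagon x a b) (g2 : G.NoPentagon a b c) (g3 : G.NoPentagon b c d)
    (g4 : G.NoPentagon c d y)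
    (h1' : G.Adj x a') (h2' : G.Adj a' b') (h3' : G.Adj b' c') (h5' : G.Adj c' d')
    (h7' : G.Adj d' y)
    (g1' : G.NoPentagon x a' b') (g2' : G.NoPentagon a' b' c') (g3' : G.NoPentagon b' c' d')
    (g4' : G.NoPentagon c' d' y) :
    a = a' ∧ b = b' ∧ c = c' ∧ d = d' := by
  by_cases haa : a = a'
  · subst haa
    exact ⟨rfl, eq_of_noPentagon_walks_four h4 h6 h8 h2 h3 h5 h7 g2 g3 g4 h2' h3' h5' h7'
      g2' g3' g4'⟩
  by_cases hdd : d = d'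
  · subst hdd
    obtain ⟨e1, e2, e3⟩ := eq_of_noPentagon_walks_four h4 h6 h8 h1 h2 h3 h5 g1 g2 g3 h1' h2'
      h3' h5' g1' g2' g3'
    exact ⟨e1, e2, e3, rfl⟩
  by_cases hbb : b = b'
  · subst hbb
    exact absurd (h4.eq_of_adj_adj g1.1 h1 h2 h1' h2') haa
  by_cases hcc : c = c'
  · subst hcc
    exact absurd (h4.eq_of_adj_adj g4.1 h5 h7 h5' h7') hdd
  exfalso
  have hxc : x ≠ c := by rintro rfl; exact g1.2.1 h3.symm
  have hxc' : x ≠ c' := by rintro rfl; exact g1'.2.1 h3'.symm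
  have had : a ≠ d := by rintro rfl; exact g2.2.1 h5.symm
  have had' : a' ≠ d' := by rintro rfl; exact g2'.2.1 h5'.symm
  have hby : b ≠ y := by rintro rfl; exact g3.2.1 h7.symm
  have hby' : b' ≠ y := by rintro rfl; exact g3'.2.1 h7'.symm
  have hxd : x ≠ d := by
    rintro rfl
    exact h4.false_of_cycle_four h1 h2 h3 h5 g1.1 g2.1
  have hxd' : x ≠ d' := by
    rintro rfl
    exact h4.false_of_cycle_four h1' h2' h3' h5' g1'.1 g2'.1
  have hay : a ≠ y := by
    rintro rfl
    exact h4.false_of_cycle_four h2 h3 h5 h7 g2.1 g3.1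
  have hay' : a' ≠ y := by
    rintro rfl
    exact h4.false_of_cycle_four h2' h3' h5' h7' g2'.1 g3'.1
  have := g1.1; have := g2.1; have := g3.1; have := g4.1
  have := g1'.1; have := g2'.1; have := g3'.1; have := g4'.1
  have := h1.ne; have := h2.ne; have := h3.ne; have := h5.ne; have := h7.ne
  have := h1'.ne; have := h2'.ne; have := h3'.ne; have := h5'.ne; have := h7'.ne
  have hxy : x ≠ y := by
    rintro rfl
    refine g1.2.2 c d h3 h5 h7 ?_
    simp only [List.nodup_cons, List.mem_cons, List.not_mem_nil, not_or]
    grind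
  have n1 : a ≠ b' := by rintro rfl; exact g1'.2.1 h1
  have n2 : b ≠ a' := by rintro rfl; exact g1.2.1 h1'
  have n3 : c ≠ d' := by rintro rfl; exact g4.2.1 h7'
  have n4 : d ≠ c' := by rintro rfl; exact g4'.2.1 h7
  have n5 : a ≠ c' := by
    rintro rfl
    exact h4.false_of_cycle_four h1' h2' h3' h1.symm g1'.1 g2'.1
  have n6 : a' ≠ c := by
    rintro rfl
    exact h4.false_of_cycle_four h1 h2 h3 h1'.symm g1.1 g2.1
  have n7 : b ≠ d' := by
    rintro rfl
    exact h4.false_of_cycle_four h3 h5 h7 h7'.symm g3.1 g4.1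
  have n8 : b' ≠ d := by
    rintro rfl
    exact h4.false_of_cycle_four h3' h5' h7' h7.symm g3'.1 g4'.1
  -- Otherwise x a' b' b a is a pentagon through the triple x a' b'. The next three cases are alike.
  have n9 : b ≠ c' := by
    rintro rfl
    refine g1'.2.2 b a h3' h2.symm h1.symm ?_
    simp only [List.nodup_cons, List.mem_cons, List.not_mem_nil, not_or]
    grind
  have n10 : b' ≠ c := by
    rintro rfl
    refine g1.2.2 b' a' h3 h2'.symm h1'.symm ?_
    simp only [List.nodup_cons, List.mem_cons, List.not_mem_nil, not_or]
    grind
  have n11 : a ≠ d' := by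
    rintro rfl
    refine g1'.2.2 c' a h3' h5' h1.symm ?_
    simp only [List.nodup_cons, List.mem_cons, List.not_mem_nil, not_or]
    grind
  have n12 : a' ≠ d := by
    rintro rfl
    refine g1.2.2 c a' h3 h5 h1'.symm ?_
    simp only [List.nodup_cons, List.mem_cons, List.not_mem_nil, not_or]
    grind
  refine h10.false_of_cycle_ten h1 h2 h3 h5 h7 h7'.symm h5'.symm h3'.symm h2'.symm h1'.symm ?_
  simp only [List.nodup_cons, List.mem_cons, List.not_mem_nil, not_or]
  grind

open Classical in
theorem dartSum_steps_noPentagon_le [Fintype V] {G : SimpleGraph V}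
    (h4 : (cycleGraph 4).Free G) (h6 : (cycleGraph 6).Free G) (h8 : (cycleGraph 8).Free G)
    (h10 : (cycleGraph 10).Free G) :
    G.dartSum (G.steps G.NoPentagon 4) ≤ (Fintype.card V : ℝ) ^ 2 := by
  have hcount : G.dartSum (G.steps G.NoPentagon 4) =
      ((univ.filter fun p : V × V × V × V × V × V =>
      G.Adj p.1 p.2.1 ∧ (G.Adj p.2.1 p.2.2.1 ∧ G.NoPentagon p.1 p.2.1 p.2.2.1) ∧
        (G.Adj p.2.2.1 p.2.2.2.1 ∧ G.NoPentagon p.2.1 p.2.2.1 p.2.2.2.1) ∧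
        (G.Adj p.2.2.2.1 p.2.2.2.2.1 ∧ G.NoPentagon p.2.2.1 p.2.2.2.1 p.2.2.2.2.1) ∧
        G.Adj p.2.2.2.2.1 p.2.2.2.2.2 ∧
          G.NoPentagon p.2.2.2.1 p.2.2.2.2.1 p.2.2.2.2.2).card : ℝ) := by
    simp only [dartSum, steps, ite_sum_zero, ← ite_and, card_filter, Fintype.sum_prod_type,
      Nat.cast_sum, Nat.cast_ite, Nat.cast_one, Nat.cast_zero]
  rw [hcount, sq, ← Nat.cast_mul, ← Fintype.card_prod, ← card_univ, Nat.cast_le]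
  refine card_le_card_of_injOn (fun p => (p.1, p.2.2.2.2.2)) (by simp) ?_
  rintro ⟨x, a, b, c, d, y⟩ h ⟨x', a', b', c', d', y'⟩ h' heq
  simp only [coe_filter, mem_univ, true_and, Set.mem_ofPred_eq, Prod.mk.injEq] at h h' heq
  obtain ⟨rfl, rfl⟩ := heq
  obtain ⟨p1, ⟨p2, q2⟩, ⟨p3, q3⟩, ⟨p4, q4⟩, p5, q5⟩ := h
  obtain ⟨p1', ⟨p2', q2'⟩, ⟨p3', q3'⟩, ⟨p4', q4'⟩, p5', q5'⟩ := h'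
  obtain ⟨rfl, rfl, rfl, rfl⟩ := eq_of_noPentagon_walks_five h4 h6 h8 h10 p1 p2 p3 p4 p5
    q2 q3 q4 q5 p1' p2' p3' p4' p5' q2' q3' q4' q5'
  rfl

end SimpleGraph

/-! ### The trade-off between r and k -/

namespace CompletePartition

open Finset SimpleGraph

open Classical in
/-- The trade-off between `r` and `k` in an `(r, k)`-graph in which few continuations of any walk
are bad and good walks of length `j + 1` are determined by their ends. -/
theorem IsRKGraph.pow_mul_le {n : ℕ} {G : SimpleGraph (Fin n)} {r k : ℕ} (h : IsRKGraph G r k)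
    (hr : 2 ≤ r) {good : Fin n → Fin n → Fin n → Prop} {b j : ℕ}
    (hbad : ∀ u v, G.Adj u v → (univ.filter fun w => G.Adj v w ∧ ¬ good u v w).card ≤ b)
    (hsteps : G.dartSum (G.steps good j) ≤ (n : ℝ) ^ 2) :
    (((r : ℝ) - 1) / k) ^ j * (((r : ℝ) - 1) / k - j * (j + 1) * b) ≤ r * k := by
  obtain ⟨hn, hm⟩ := h.card_bounds
  have hdart : G.dartSum (fun _ _ => 1) =
      ((univ.filter fun x : Fin n × Fin n => G.Adj x.1 x.2).card : ℝ) := by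
    simp only [dartSum, card_filter, Fintype.sum_prod_type,
      Nat.cast_sum, Nat.cast_ite, Nat.cast_one, Nat.cast_zero]
  set m : ℕ := (univ.filter fun x : Fin n × Fin n => G.Adj x.1 x.2).card with hmdef
  have hr1 : (0 : ℝ) < (r : ℝ) - 1 := by
    have : (2 : ℝ) ≤ r := by exact_mod_cast hr
    linarith
  have hmr : (r : ℝ) * (r - 1) ≤ m := by
    have : ((r * (r - 1) : ℕ) : ℝ) ≤ m := by exact_mod_cast hm
    rwa [Nat.cast_mul, Nat.cast_sub (by omega), Nat.cast_one] at this
  have hnr : (n : ℝ) ≤ r * k := by exact_mod_cast hn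
  have hm0 : (0 : ℝ) < m := lt_of_lt_of_le (by positivity) hmr
  have hn0 : (0 : ℝ) < n := by
    rcases Nat.eq_zero_or_pos n with h0 | h0
    · subst h0
      simp [hmdef] at hm0
    · exact_mod_cast h0
  have hk0 : (0 : ℝ) < k := by
    by_contra hk
    have : (k : ℝ) = 0 := le_antisymm (not_lt.1 hk) (by positivity)
    rw [this] at hnr
    linarith
  have hD0 : ((r : ℝ) - 1) / k ≤ m / n := by
    rw [div_le_div_iff₀ hk0 hn0]
    nlinarith
  have key := le_dartSum_steps hbad j (D := (m : ℝ) / n) (by positivity)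
    (by rw [hdart, Fintype.card_fin, div_mul_cancel₀ _ hn0.ne'])
  have key2 := key.trans hsteps
  rw [Fintype.card_fin, sq, ← mul_assoc] at key2
  have key3 := le_of_mul_le_mul_right key2 hn0
  -- With a nonpositive second factor the claim is trivial; otherwise the left side increases with
  -- the average degree, which may be lowered from m / n to (r - 1) / k.
  by_cases hC : ((r : ℝ) - 1) / k - j * (j + 1) * b ≤ 0
  · exact (mul_nonpos_of_nonneg_of_nonpos (by positivity) hC).trans (by positivity)
  · rw [not_le] at hC
    refine le_trans ?_ (key3.trans hnr)
    gcongr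

/-- The constant 12 is j(j + 1)b for j = 2 and b = 2. -/
theorem IsRKGraph.sq_mul_le {n : ℕ} {G : SimpleGraph (Fin n)} {r k : ℕ} (h : IsRKGraph G r k)
    (hr : 2 ≤ r) (hG : FamilyFree {C 4, C 6} G) :
    (((r : ℝ) - 1) / k) ^ 2 * (((r : ℝ) - 1) / k - 12) ≤ r * k := by
  have h4 : (cycleGraph 4).Free G := hG (C 4) (by simp)
  have h6 : (cycleGraph 6).Free G := hG (C 6) (by simp)
  have := h.pow_mul_le hr (fun u v huv => h4.card_filter_not_noTriangle_le huv)
    (by simpa using dartSum_steps_noTriangle_le h4 h6)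
  norm_num at this
  exact this

/-- The constant 40 is j(j + 1)b for j = 4 and b = 2. -/
theorem IsRKGraph.pow_four_mul_le {n : ℕ} {G : SimpleGraph (Fin n)} {r k : ℕ}
    (h : IsRKGraph G r k) (hr : 2 ≤ r) (hG : FamilyFree {C 4, C 6, C 8, C 10} G) :
    (((r : ℝ) - 1) / k) ^ 4 * (((r : ℝ) - 1) / k - 40) ≤ r * k := by
  have h4 : (cycleGraph 4).Free G := hG (C 4) (by simp)
  have h6 : (cycleGraph 6).Free G := hG (C 6) (by simp)
  have h8 : (cycleGraph 8).Free G := hG (C 8) (by simp)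
  have h10 : (cycleGraph 10).Free G := hG (C 10) (by simp)
  have := h.pow_mul_le hr (fun u v huv => card_filter_not_noPentagon_le h4 h6 h8 huv)
    (by simpa using dartSum_steps_noPentagon_le h4 h6 h8 h10)
  norm_num at this
  exact this

/-- A real number `k` satisfying the trade-off between `r ≈ q ^ l` and `k` is not much smaller than
the extremal value. -/
theorem le_of_pow_mul_le {j : ℕ} {q r g k c ε : ℝ} (hq : 1 < q) (hε : 0 < ε) (hε1 : ε < 1)
    (hlarge : 1 + c < ε * q) (hc : 0 ≤ c) (hk : 0 < k) (hg : 0 < g) (hgq : g * q = r) (hg1 : 1 ≤ g)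
    (hrg : r * g = q ^ (j + 1))
    (h : ((r - 1) / k) ^ j * ((r - 1) / k - c) ≤ r * k) : (1 - ε) * g ≤ k := by
  by_contra! hlt
  -- For k < (1 - ε)g the gain εq > 1 + c absorbs `c` and the 1 in r - 1 = gq - 1 ≥ g(q - 1). The
  -- trade-off then gives q^(j+1) ≤ rk < rg = q^(j+1).
  have h1 : q + c < (r - 1) / k := by
    rw [lt_div_iff₀ hk]
    have h2 : (q + c) * k ≤ (q + c) * ((1 - ε) * g) := by gcongr
    have h3 : (q + c) * (1 - ε) < q - 1 := by nlinarith
    nlinarith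
  have h2 : q < (r - 1) / k - c := by linarith
  have h3 : q ^ j * q ≤ ((r - 1) / k) ^ j * ((r - 1) / k - c) := by
    have : 0 ≤ (r - 1) / k := by linarith
    gcongr
    linarith
  have h4 : r * k < r * g := by
    have : 0 < r := by rw [← hgq]; positivity
    have : k < g := by nlinarith
    gcongr
  rw [← pow_succ] at h3
  linarith

end CompletePartition

/-! ### A square root of the Frobenius -/

section OddDegreeField

/-- A finite field of order `p ^ (2 * e + 1)` has an endomorphism whose square is the Frobenius. -/
theorem exists_ringHom_comp_self_eq_pow {K : Type*} [Field K] [Finite K] (p e : ℕ) [Fact p.Prime]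
    [CharP K p] (hK : Nat.card K = p ^ (2 * e + 1)) :
    ∃ σ : K →+* K, ∀ x, σ (σ x) = x ^ p := by
  -- Applied twice this is the (2e + 2)-th power of the Frobenius, whose (2e + 1)-th power is the
  -- identity.
  refine ⟨iterateFrobenius K p (e + 1), fun x => ?_⟩
  have := Fintype.ofFinite K
  rw [iterateFrobenius_def, iterateFrobenius_def, ← pow_mul, ← pow_add,
    show e + 1 + (e + 1) = (2 * e + 1) + 1 by ring, pow_succ, pow_mul, ← hK,
    Nat.card_eq_fintype_card, FiniteField.pow_card]

end OddDegreeField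

/-! ### The affine split Cayley hexagon in coordinates -/

section CyclicSums

variable {K : Type*} [Field K]

/-- The incidence relation of the affine part of the split Cayley hexagon in characteristic three,
between points `(x, p₁, p₂, p₃, p₄)` and lines `(y, l₁, l₂, l₃, l₄)`. -/
def HexInc (p l : Fin 5 → K) : Prop :=
  p 1 + l 1 = p 0 * l 0 ∧ p 2 + l 2 = p 0 ^ 2 * l 0 ∧ p 3 + l 3 = p 0 ^ 3 * l 0 ∧
    p 4 + l 4 = p 0 ^ 3 * l 0 ^ 2

/-- In the alternating sum of one incidence equation around a closed path the left sides cancel,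
leaving a relation among the first coordinates. -/
theorem HexInc.no_cycle_four {p₀ p₁ l₀ l₁ : Fin 5 → K} (h₁ : HexInc p₀ l₀) (h₂ : HexInc p₁ l₀)
    (h₃ : HexInc p₁ l₁) (h₄ : HexInc p₀ l₁) (hx : p₀ 0 ≠ p₁ 0) (hy : l₀ 0 ≠ l₁ 0) : False := by
  have : (p₀ 0 - p₁ 0) * (l₀ 0 - l₁ 0) = 0 := by
    linear_combination -h₁.1 + h₂.1 - h₃.1 + h₄.1
  rcases mul_eq_zero.1 this with h | h
  · exact hx (sub_eq_zero.1 h)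
  · exact hy (sub_eq_zero.1 h)

/-- With x_i, y_i the first coordinates, the alternating sums give Σ y_i (f(x_i) - f(x_{i+1})) = 0
for f = X and f = X². Taking f equal to (X - x₁)(X - x₂) up to a constant leaves only the terms at
x₀. -/
theorem HexInc.no_cycle_six {p₀ p₁ p₂ l₀ l₁ l₂ : Fin 5 → K} (h₁ : HexInc p₀ l₀)
    (h₂ : HexInc p₁ l₀) (h₃ : HexInc p₁ l₁) (h₄ : HexInc p₂ l₁) (h₅ : HexInc p₂ l₂)
    (h₆ : HexInc p₀ l₂) (hx₀ : p₀ 0 ≠ p₁ 0) (hx₂ : p₀ 0 ≠ p₂ 0) (hy : l₀ 0 ≠ l₂ 0) : False := by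
  have : (l₀ 0 - l₂ 0) * ((p₀ 0 - p₁ 0) * (p₀ 0 - p₂ 0)) = 0 := by
    linear_combination (-h₁.2.1 + h₂.2.1 - h₃.2.1 + h₄.2.1 - h₅.2.1 + h₆.2.1)
      - (p₁ 0 + p₂ 0) * (-h₁.1 + h₂.1 - h₃.1 + h₄.1 - h₅.1 + h₆.1)
  simp [sub_eq_zero, hx₀, hx₂, hy] at this

/-- The elimination of `no_cycle_six`, with the cubic vanishing at x₁, x₂, x₃. -/
theorem HexInc.eq_of_cycle_eight {p₀ p₁ p₂ p₃ l₀ l₁ l₂ l₃ : Fin 5 → K} (h₁ : HexInc p₀ l₀)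
    (h₂ : HexInc p₁ l₀) (h₃ : HexInc p₁ l₁) (h₄ : HexInc p₂ l₁) (h₅ : HexInc p₂ l₂)
    (h₆ : HexInc p₃ l₂) (h₇ : HexInc p₃ l₃) (h₈ : HexInc p₀ l₃)
    (hx₀ : p₀ 0 ≠ p₁ 0) (hx₃ : p₀ 0 ≠ p₃ 0) (hy : l₀ 0 ≠ l₃ 0) : p₀ 0 = p₂ 0 := by
  have e : (l₀ 0 - l₃ 0) * ((p₀ 0 - p₁ 0) * (p₀ 0 - p₂ 0) * (p₀ 0 - p₃ 0)) = 0 := by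
    linear_combination
      (-h₁.2.2.1 + h₂.2.2.1 - h₃.2.2.1 + h₄.2.2.1 - h₅.2.2.1 + h₆.2.2.1 - h₇.2.2.1 + h₈.2.2.1)
      - (p₁ 0 + p₂ 0 + p₃ 0) *
        (-h₁.2.1 + h₂.2.1 - h₃.2.1 + h₄.2.1 - h₅.2.1 + h₆.2.1 - h₇.2.1 + h₈.2.1)
      + (p₁ 0 * p₂ 0 + p₁ 0 * p₃ 0 + p₂ 0 * p₃ 0) *
        (-h₁.1 + h₂.1 - h₃.1 + h₄.1 - h₅.1 + h₆.1 - h₇.1 + h₈.1)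
  simp only [mul_eq_zero, sub_eq_zero, hx₀, hx₃, hy, false_or, or_false] at e
  exact e

/-- By `eq_of_cycle_eight`, read from two starting points, the first coordinates of the points
alternate between two values. The first and fourth equations then give y₀ + y₂ = y₁ + y₃ and the
same for squares, so y₀ is y₁ or y₃. -/
theorem HexInc.no_cycle_eight (h3 : (3 : K) = 0) {p₀ p₁ p₂ p₃ l₀ l₁ l₂ l₃ : Fin 5 → K}
    (h₁ : HexInc p₀ l₀) (h₂ : HexInc p₁ l₀) (h₃ : HexInc p₁ l₁) (h₄ : HexInc p₂ l₁)
    (h₅ : HexInc p₂ l₂) (h₆ : HexInc p₃ l₂) (h₇ : HexInc p₃ l₃) (h₈ : HexInc p₀ l₃)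
    (hx₀ : p₀ 0 ≠ p₁ 0) (hx₁ : p₁ 0 ≠ p₂ 0) (hx₃ : p₀ 0 ≠ p₃ 0)
    (hy₀ : l₀ 0 ≠ l₁ 0) (hy₃ : l₀ 0 ≠ l₃ 0) : False := by
  have e02 := eq_of_cycle_eight h₁ h₂ h₃ h₄ h₅ h₆ h₇ h₈ hx₀ hx₃ hy₃
  have e13 := eq_of_cycle_eight h₃ h₄ h₅ h₆ h₇ h₈ h₁ h₂ hx₁ hx₀.symm hy₀.symm
  have e1 : (p₀ 0 - p₁ 0) * (l₀ 0 + l₂ 0 - l₁ 0 - l₃ 0) = 0 := by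
    have h₄' := h₄.1
    have h₅' := h₅.1
    have h₆' := h₆.1
    have h₇' := h₇.1
    rw [← e02] at h₄' h₅'
    rw [← e13] at h₆' h₇'
    linear_combination -h₁.1 + h₂.1 - h₃.1 + h₄' - h₅' + h₆' - h₇' + h₈.1
  have e2 : (p₀ 0 - p₁ 0) ^ 3 * (l₀ 0 ^ 2 + l₂ 0 ^ 2 - l₁ 0 ^ 2 - l₃ 0 ^ 2) = 0 := by
    have h₄' := h₄.2.2.2
    have h₅' := h₅.2.2.2
    have h₆' := h₆.2.2.2
    have h₇' := h₇.2.2.2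
    rw [← e02] at h₄' h₅'
    rw [← e13] at h₆' h₇'
    linear_combination -h₁.2.2.2 + h₂.2.2.2 - h₃.2.2.2 + h₄' - h₅' + h₆' - h₇' + h₈.2.2.2 -
      p₀ 0 * p₁ 0 * (p₀ 0 - p₁ 0) * (l₀ 0 ^ 2 + l₂ 0 ^ 2 - l₁ 0 ^ 2 - l₃ 0 ^ 2) * h3
  have hx : p₀ 0 - p₁ 0 ≠ 0 := sub_ne_zero.2 hx₀
  have f1 := (mul_eq_zero.1 e1).resolve_left hx
  have f2 := (mul_eq_zero.1 e2).resolve_left (pow_ne_zero 3 hx)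
  have : (l₀ 0 - l₁ 0) * (l₀ 0 - l₃ 0) = 0 := by
    linear_combination (l₀ 0 - l₁ 0) * (l₀ 0 - l₃ 0) * h3 - f2 +
      (l₂ 0 - l₀ 0 + l₁ 0 + l₃ 0) * f1
  simp [sub_eq_zero, hy₀, hy₃] at this

/-- The coordinates of a line, normalised with respect to a point: they are to be matched by the
coordinates of a path from the point to the line. -/
def hexShift (p l : Fin 5 → K) : Fin 4 → K :=
  ![p 1 + l 1 - p 0 * l 0,
    p 2 + l 2 - 2 * p 0 * (p 1 + l 1) + p 0 ^ 2 * l 0,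
    p 3 + l 3 - p 0 ^ 3 * l 0,
    p 4 + l 4 - 2 * l 0 * (p 3 + l 3 - p 0 ^ 3 * l 0) - p 0 ^ 3 * l 0 ^ 2]

/-- The equations satisfied by the normalised coordinates of a path of length five. -/
def HexPath (k : Fin 4 → K) (u w α β : K) : Prop :=
  k 0 = α + β ∧ k 1 = u * (α - β) - w * β ∧ k 2 = u ^ 2 * α + w ^ 2 * β ∧
    k 3 = -(u * α ^ 2) + w * β ^ 2

/-- Alternating sums along the path, with first coordinates measured from those of its end point
`p₀` and end line `l₂`. Cubing is additive in characteristic three. -/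
theorem HexInc.hexPath (h3 : (3 : K) = 0) {p₀ l₀ p₁ l₁ p₂ l₂ : Fin 5 → K} (h₁ : HexInc p₀ l₀)
    (h₂ : HexInc p₁ l₀) (h₃ : HexInc p₁ l₁) (h₄ : HexInc p₂ l₁) (h₅ : HexInc p₂ l₂) :
    HexPath (hexShift p₀ l₂) (p₁ 0 - p₀ 0) (p₁ 0 - p₂ 0) (-((p₁ 0 - p₀ 0) * (l₀ 0 - l₂ 0)))
      ((p₁ 0 - p₂ 0) * (l₁ 0 - l₂ 0)) := by
  have hu : p₁ 0 ^ 3 - p₀ 0 ^ 3 = (p₁ 0 - p₀ 0) ^ 3 := by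
    linear_combination p₁ 0 * p₀ 0 * (p₁ 0 - p₀ 0) * h3
  have hw : p₁ 0 ^ 3 - p₂ 0 ^ 3 = (p₁ 0 - p₂ 0) ^ 3 := by
    linear_combination p₁ 0 * p₂ 0 * (p₁ 0 - p₂ 0) * h3
  have e3 : p₀ 3 + l₂ 3 - p₀ 0 ^ 3 * l₂ 0 =
      -((p₁ 0 - p₀ 0) ^ 3 * (l₀ 0 - l₂ 0)) + (p₁ 0 - p₂ 0) ^ 3 * (l₁ 0 - l₂ 0) := by
    linear_combination h₁.2.2.1 - h₂.2.2.1 + h₃.2.2.1 - h₄.2.2.1 + h₅.2.2.1 -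
      (l₀ 0 - l₂ 0) * hu + (l₁ 0 - l₂ 0) * hw
  refine ⟨?_, ?_, ?_, ?_⟩
  · simp only [hexShift, Matrix.cons_val]
    linear_combination h₁.1 - h₂.1 + h₃.1 - h₄.1 + h₅.1
  · simp only [hexShift, Matrix.cons_val]
    linear_combination h₁.2.1 - h₂.2.1 + h₃.2.1 - h₄.2.1 + h₅.2.1 -
      2 * p₀ 0 * (h₁.1 - h₂.1 + h₃.1 - h₄.1 + h₅.1) +
      (p₁ 0 - p₀ 0) * (p₁ 0 - p₂ 0) * (l₁ 0 - l₂ 0) * h3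
  · simp only [hexShift, Matrix.cons_val]
    linear_combination e3
  · simp only [hexShift, Matrix.cons_val]
    linear_combination h₁.2.2.2 - h₂.2.2.2 + h₃.2.2.2 - h₄.2.2.2 + h₅.2.2.2 - 2 * l₂ 0 * e3 -
      (l₀ 0 ^ 2 - l₂ 0 ^ 2) * hu + (l₁ 0 ^ 2 - l₂ 0 ^ 2) * hw

/-- Conversely a solution of the path equations closes up to a path. -/
theorem HexInc.of_hexPath (h3 : (3 : K) = 0) {p₀ l₀ p₁ l₁ p₂ l₂ : Fin 5 → K} (h₁ : HexInc p₀ l₀)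
    (h₂ : HexInc p₁ l₀) (h₃ : HexInc p₁ l₁) (h₄ : HexInc p₂ l₁)
    (h : HexPath (hexShift p₀ l₂) (p₁ 0 - p₀ 0) (p₁ 0 - p₂ 0)
      (-((p₁ 0 - p₀ 0) * (l₀ 0 - l₂ 0))) ((p₁ 0 - p₂ 0) * (l₁ 0 - l₂ 0))) : HexInc p₂ l₂ := by
  have hu : p₁ 0 ^ 3 - p₀ 0 ^ 3 = (p₁ 0 - p₀ 0) ^ 3 := by
    linear_combination p₁ 0 * p₀ 0 * (p₁ 0 - p₀ 0) * h3
  have hw : p₁ 0 ^ 3 - p₂ 0 ^ 3 = (p₁ 0 - p₂ 0) ^ 3 := by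
    linear_combination p₁ 0 * p₂ 0 * (p₁ 0 - p₂ 0) * h3
  obtain ⟨k1, k2, k3, k4⟩ := h
  simp only [hexShift, Matrix.cons_val] at k1 k2 k3 k4
  have i1 : p₂ 1 + l₂ 1 = p₂ 0 * l₂ 0 := by
    linear_combination k1 - (h₁.1 - h₂.1 + h₃.1 - h₄.1)
  refine ⟨i1, ?_, ?_, ?_⟩
  · linear_combination k2 - (h₁.2.1 - h₂.2.1 + h₃.2.1 - h₄.2.1) +
      2 * p₀ 0 * (h₁.1 - h₂.1 + h₃.1 - h₄.1 + i1) -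
      (p₁ 0 - p₀ 0) * (p₁ 0 - p₂ 0) * (l₁ 0 - l₂ 0) * h3
  · linear_combination k3 - (h₁.2.2.1 - h₂.2.2.1 + h₃.2.2.1 - h₄.2.2.1) +
      (l₀ 0 - l₂ 0) * hu - (l₁ 0 - l₂ 0) * hw
  · linear_combination k4 + 2 * l₂ 0 * k3 - (h₁.2.2.2 - h₂.2.2.2 + h₃.2.2.2 - h₄.2.2.2) +
      (l₀ 0 ^ 2 - l₂ 0 ^ 2) * hu - (l₁ 0 ^ 2 - l₂ 0 ^ 2) * hw

/-- The determinant of the linear system which the path equations imply. -/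
def hexDet (k : Fin 4 → K) : K := k 0 ^ 2 * k 2 + k 1 * (k 0 * k 1 - k 3)

/-- In characteristic three the path equations imply two equations linear in `u` and `β` (`e1` and
`e2`); this is Cramer's rule for them. -/
theorem HexPath.mul_hexDet (h3 : (3 : K) = 0) {k : Fin 4 → K} {u w α β : K}
    (h : HexPath k u w α β) :
    u * hexDet k = -(k 2 * k 3 + k 1 ^ 3) ∧ β * hexDet k = (k 0 * k 1 + k 3) ^ 2 := by
  obtain ⟨k1, k2, k3, k4⟩ := h
  have e1 : k 3 = -(u * k 0 ^ 2) - β * k 1 := by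
    rw [k1, k2, k4]
    linear_combination u * α * β * h3
  have e2 : u * (k 0 * k 1 - k 3) + k 1 ^ 2 = k 2 * β := by
    rw [k1, k2, k3, k4]
    linear_combination (u ^ 2 * α ^ 2 - u ^ 2 * α * β - u * w * α * β) * h3
  unfold hexDet
  constructor
  · linear_combination k 1 * e2 + k 2 * e1
  · linear_combination -(k 0 ^ 2) * e2 + (k 0 * k 1 - k 3) * e1 - k 0 * k 1 * k 3 * h3

/-- The hypotheses make k₀k₁ + k₃ nonzero, hence also the determinant. So `u` and `β` are
determined, then `α` by the first equation and `w` by the second. -/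
theorem HexPath.eq_of_ne_zero (h3 : (3 : K) = 0) {k : Fin 4 → K} {u w α β u' w' α' β' : K}
    (h : HexPath k u w α β) (h' : HexPath k u' w' α' β') (hβ : β ≠ 0) (hd : u * β + w * α ≠ 0) :
    u = u' ∧ w = w' := by
  have e : k 0 * k 1 + k 3 = -(β * (u * β + w * α)) := by
    rw [h.1, h.2.1, h.2.2.2]
    ring
  have hne : k 0 * k 1 + k 3 ≠ 0 := by
    rw [e]
    exact neg_ne_zero.2 (mul_ne_zero hβ hd)
  obtain ⟨m1, m2⟩ := h.mul_hexDet h3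
  obtain ⟨m1', m2'⟩ := h'.mul_hexDet h3
  have hdet : hexDet k ≠ 0 := by
    intro h0
    rw [h0, mul_zero] at m2
    exact pow_ne_zero 2 hne m2.symm
  have hu : u = u' := mul_right_cancel₀ hdet (m1.trans m1'.symm)
  have hb : β = β' := mul_right_cancel₀ hdet (m2.trans m2'.symm)
  subst hu hb
  have ha : α = α' := by
    have := h.1.symm.trans h'.1
    exact add_right_cancel this
  subst ha
  have := h.2.1.symm.trans h'.2.1
  exact ⟨rfl, mul_right_cancel₀ hβ (sub_right_injective this)⟩

/-- A 10-cycle consists of two paths of length five from `p₀` to `l₂`. Uniqueness of `u` and `w`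
gives p₂ and p₃ the same first coordinate. The nondegeneracy term uβ + wα equals uw times the
difference of the first coordinates of `l₁` and `l₀`. -/
theorem HexInc.no_cycle_ten (h3 : (3 : K) = 0) {p₀ p₁ p₂ p₃ p₄ l₀ l₁ l₂ l₃ l₄ : Fin 5 → K}
    (h₁ : HexInc p₀ l₀) (h₂ : HexInc p₁ l₀) (h₃ : HexInc p₁ l₁) (h₄ : HexInc p₂ l₁)
    (h₅ : HexInc p₂ l₂) (h₆ : HexInc p₃ l₂) (h₇ : HexInc p₃ l₃) (h₈ : HexInc p₄ l₃)
    (h₉ : HexInc p₄ l₄) (h₁₀ : HexInc p₀ l₄)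
    (hx₀ : p₀ 0 ≠ p₁ 0) (hx₁ : p₁ 0 ≠ p₂ 0) (hx₂ : p₂ 0 ≠ p₃ 0)
    (hy₀ : l₀ 0 ≠ l₁ 0) (hy₁ : l₁ 0 ≠ l₂ 0) : False := by
  have a := h₁.hexPath h3 h₂ h₃ h₄ h₅
  have b := h₁₀.hexPath h3 h₉ h₈ h₇ h₆
  have h1 : p₁ 0 - p₀ 0 ≠ 0 := sub_ne_zero.2 hx₀.symm
  have h2 : p₁ 0 - p₂ 0 ≠ 0 := sub_ne_zero.2 hx₁
  have h4 : l₁ 0 - l₂ 0 ≠ 0 := sub_ne_zero.2 hy₁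
  have h5 : l₁ 0 - l₀ 0 ≠ 0 := sub_ne_zero.2 hy₀.symm
  obtain ⟨e1, e2⟩ := a.eq_of_ne_zero h3 b (mul_ne_zero h2 h4) (by
    have := mul_ne_zero (mul_ne_zero h1 h2) h5
    contrapose! this
    linear_combination this)
  exact hx₂ (by linear_combination e1 - e2)

/-- The path equations are solvable outside four hypersurfaces. -/
theorem exists_hexPath (h3 : (3 : K) = 0) {k : Fin 4 → K} (hdet : hexDet k ≠ 0)
    (hu : k 2 * k 3 + k 1 ^ 3 ≠ 0) (hβ : k 0 * k 1 + k 3 ≠ 0)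
    (hw : k 2 * k 3 ^ 2 - k 3 * k 1 ^ 3 + k 0 ^ 3 * k 2 ^ 2 ≠ 0) :
    ∃ u w y z : K, HexPath k u w (-(u * y)) (w * z) := by
  -- Cramer's rule gives `u` and `β`, the first equation α = k₀ - β, the second `w`. The other
  -- hypotheses make `u`, `β` and `w` nonzero, so that y = -α/u and z = β/w exist.
  obtain ⟨u, hu'⟩ : ∃ u, u * hexDet k = -(k 2 * k 3 + k 1 ^ 3) :=
    ⟨_, div_mul_cancel₀ _ hdet⟩
  obtain ⟨β, hβ'⟩ : ∃ β, β * hexDet k = (k 0 * k 1 + k 3) ^ 2 := ⟨_, div_mul_cancel₀ _ hdet⟩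
  have hu0 : u ≠ 0 := by
    rintro rfl
    rw [zero_mul, eq_comm, neg_eq_zero] at hu'
    exact hu hu'
  have hβ0 : β ≠ 0 := by
    rintro rfl
    rw [zero_mul] at hβ'
    exact pow_ne_zero 2 hβ hβ'.symm
  have e1 : k 3 = -(u * k 0 ^ 2) - β * k 1 := by
    refine mul_right_cancel₀ hdet ?_
    have : hexDet k = k 0 ^ 2 * k 2 + k 1 * (k 0 * k 1 - k 3) := rfl
    linear_combination k 0 ^ 2 * hu' + k 1 * hβ' + k 3 * this + k 0 * k 1 ^ 2 * k 3 * h3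
  have e2 : u * (k 0 * k 1 - k 3) + k 1 ^ 2 = k 2 * β := by
    refine mul_right_cancel₀ hdet ?_
    have : hexDet k = k 0 ^ 2 * k 2 + k 1 * (k 0 * k 1 - k 3) := rfl
    linear_combination (k 0 * k 1 - k 3) * hu' - k 2 * hβ' + k 1 ^ 2 * this -
      k 0 * k 1 * k 2 * k 3 * h3
  obtain ⟨w, hw'⟩ : ∃ w, w * β = u * (k 0 - β - β) - k 1 := ⟨_, div_mul_cancel₀ _ hβ0⟩
  have f4 : k 3 = -(u * (k 0 - β) ^ 2) + w * β ^ 2 := by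
    linear_combination e1 - β * hw' - u * β * (k 0 - β) * h3
  have f3 : k 2 = u ^ 2 * (k 0 - β) + w ^ 2 * β := by
    refine mul_right_cancel₀ hβ0 ?_
    have k1' : k 1 = u * (k 0 - β - β) - w * β := by linear_combination hw'
    rw [← e2, f4, k1']
    linear_combination (u ^ 2 * (k 0 - β) ^ 2 - u ^ 2 * (k 0 - β) * β -
      u * w * (k 0 - β) * β) * h3
  have hw0 : w ≠ 0 := by
    rintro rfl
    apply hw
    have k1' : k 1 = u * (k 0 - β - β) := by linear_combination hw'
    rw [f3, f4, k1']
    linear_combination u ^ 4 * (11 * k 0 * β ^ 4 - 16 * k 0 ^ 2 * β ^ 3 + 12 * k 0 ^ 3 * β ^ 2 -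
      5 * k 0 ^ 4 * β + k 0 ^ 5 - 3 * β ^ 5) * h3
  refine ⟨u, w, -((k 0 - β) / u), β / w, ?_⟩
  rw [show -(u * -((k 0 - β) / u)) = k 0 - β by field_simp,
    show w * (β / w) = β by field_simp]
  exact ⟨by ring, by linear_combination hw', f3, f4⟩

end CyclicSums

/-! ### Roots of polynomials involving σ -/

section TwistedRoots

open Polynomial Finset

variable {K : Type*} [Field K] [Fintype K] [DecidableEq K] {σ : K →+* K}

theorem card_filter_le_of_isRoot {p : K[X]} (hp : p ≠ 0) {n : ℕ} (hn : p.natDegree ≤ n)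
    {P : K → Prop} [DecidablePred P] (h : ∀ x, P x → p.eval x = 0) :
    (univ.filter P).card ≤ n := by
  refine (card_le_card (t := p.roots.toFinset) fun x hx => ?_).trans
    ((Multiset.toFinset_card_le _).trans ((card_roots' p).trans hn))
  rw [Multiset.mem_toFinset, mem_roots hp]
  exact h x (mem_filter.1 hx).2

/-- Applying σ to σz = κz + B and substituting it again makes `z` a root of a monic cubic. -/
theorem card_filter_twisted_linear_le (hσ : ∀ x, σ (σ x) = x ^ 3) (κ B : K) :
    (univ.filter fun z => κ * z + B - σ z = 0).card ≤ 3 := by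
  refine card_filter_le_of_isRoot
    (p := X ^ 3 - C (σ κ) * (C κ * X + C B) - C (σ B)) ?_ (by compute_degree) ?_
  · intro h
    have : (X ^ 3 - C (σ κ) * (C κ * X + C B) - C (σ B) : K[X]).coeff 3 = 1 := by
      compute_degree!
    rw [h] at this
    simp at this
  · intro z hz
    have h1 : σ z = κ * z + B := (sub_eq_zero.1 hz).symm
    have h2 := hσ z
    rw [h1, map_add, map_mul, h1] at h2
    simp only [eval_sub, eval_mul, eval_add, eval_pow, eval_X, eval_C]
    linear_combination -h2

/-- The equation reads zσz = N(z). Applying σ, multiplying by z² and substituting N(z) eliminates σz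
and leaves a sextic with leading coefficient -κ. -/
theorem card_filter_twisted_quadratic_le (hσ : ∀ x, σ (σ x) = x ^ 3) {κ : K} (hκ : κ ≠ 0)
    (B D : K) : (univ.filter fun z => D + κ * z ^ 2 - z * (B - σ z) = 0).card ≤ 6 := by
  let N : K[X] := C B * X - C κ * X ^ 2 - C D
  refine card_filter_le_of_isRoot
    (p := N * X ^ 4 - C (σ B) * N * X + C (σ κ) * N ^ 2 + C (σ D) * X ^ 2) ?_ ?_ ?_
  · intro h
    have : (N * X ^ 4 - C (σ B) * N * X + C (σ κ) * N ^ 2 + C (σ D) * X ^ 2 : K[X]).coeff 6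
        = -κ := by
      simp only [N]
      compute_degree!
    rw [h] at this
    simp [hκ] at this
  · simp only [N]
    compute_degree
  · intro z hz
    have h1 : z * σ z = B * z - κ * z ^ 2 - D := by linear_combination hz
    have h2 : σ z * z ^ 3 = σ B * σ z - σ κ * σ z ^ 2 - σ D := by
      rw [← hσ z, ← map_mul, h1, map_sub, map_sub, map_mul, map_mul, map_pow]
    simp only [N, eval_sub, eval_mul, eval_add, eval_pow, eval_X, eval_C]
    rw [← h1]
    linear_combination z ^ 2 * h2

/-- Few values of `r` are exceptional for the solvability of the path equations. -/
theorem card_hexPath_exceptions_le (hσ : ∀ x, σ (σ x) = x ^ 3) {κ₀ κ₂ : K} (h₀ : κ₀ ≠ 0)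
    (h₂ : κ₂ ≠ 0) (A B : K) :
    (univ.filter fun r => κ₀ * (A - r) + (B + σ r) = 0 ∨ κ₂ * (B + σ r) + (A - r) ^ 3 = 0 ∨
      κ₀ ^ 2 * κ₂ + (A - r) * (κ₀ * (A - r) - (B + σ r)) = 0 ∨
      κ₂ * (B + σ r) ^ 2 - (B + σ r) * (A - r) ^ 3 + κ₀ ^ 3 * κ₂ ^ 2 = 0).card ≤ 18 := by
  have hA : ∀ {P : K → Prop} [DecidablePred P] {n : ℕ}, (univ.filter P).card ≤ n →
      (univ.filter fun r => P (A - r)).card ≤ n := by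
    intro P _ n h
    refine (card_le_card_of_injOn (fun r => A - r) ?_ ?_).trans h
    · intro r hr
      simpa using hr
    · intro r _ r' _ h
      simpa using h
  have hB : ∀ {P : K → Prop} [DecidablePred P] {n : ℕ}, (univ.filter P).card ≤ n →
      (univ.filter fun r => P (B + σ r)).card ≤ n := by
    intro P _ n h
    refine (card_le_card_of_injOn (fun r => B + σ r) ?_ ?_).trans h
    · intro r hr
      simpa using hr
    · intro r _ r' _ h
      exact σ.injective (by simpa using h)
  -- For z = A - r one has B + σr = B + σA - σz; for z = B + σr one has (A - r)³ = σ(B + σA) - σz.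
  -- Each condition is then twisted linear or quadratic in one of these variables.
  have c1 := hA (card_filter_twisted_linear_le hσ κ₀ (B + σ A))
  have c2 := hB (card_filter_twisted_linear_le hσ κ₂ (σ (B + σ A)))
  have c3 := hA (card_filter_twisted_quadratic_le hσ h₀ (B + σ A) (κ₀ ^ 2 * κ₂))
  have c4 := hB (card_filter_twisted_quadratic_le hσ h₂ (σ (B + σ A)) (κ₀ ^ 3 * κ₂ ^ 2))
  have hσr : ∀ r, σ (A - r) = σ A - σ r := fun r => map_sub _ _ _
  have hcube : ∀ r, σ (B + σ A) - σ (B + σ r) = (A - r) ^ 3 := fun r => by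
    rw [← map_sub, ← hσ, map_sub σ A r]
    congr 1
    ring
  calc _ ≤ ((univ.filter fun r => κ₀ * (A - r) + (B + σ A) - σ (A - r) = 0) ∪
        ((univ.filter fun r => κ₂ * (B + σ r) + σ (B + σ A) - σ (B + σ r) = 0) ∪
        ((univ.filter fun r => κ₀ ^ 2 * κ₂ + κ₀ * (A - r) ^ 2 -
          (A - r) * (B + σ A - σ (A - r)) = 0) ∪
        (univ.filter fun r => κ₀ ^ 3 * κ₂ ^ 2 + κ₂ * (B + σ r) ^ 2 -
          (B + σ r) * (σ (B + σ A) - σ (B + σ r)) = 0)))).card := by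
        refine card_le_card fun r hr => ?_
        simp only [mem_filter, mem_univ, true_and, mem_union, hσr] at hr ⊢
        rcases hr with h | h | h | h
        · left
          linear_combination h
        · right; left
          rw [add_sub_assoc, hcube, h]
        · right; right; left
          linear_combination h
        · right; right; right
          rw [hcube]
          linear_combination h
    _ ≤ 3 + (3 + (6 + 6)) := by
        refine (card_union_le _ _).trans (add_le_add c1 ?_)
        refine (card_union_le _ _).trans (add_le_add c2 ?_)
        exact (card_union_le _ _).trans (add_le_add c3 c4)
    _ = 18 := by norm_num

end TwistedRoots

/-! ### The polarity graph of the hexagon -/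

section HexagonPolarity

open Finset SimpleGraph

variable {K : Type*} [Field K] (σ : K →+* K)

/-- The point of the affine hexagon given by a vertex of its polarity quotient. -/
def hexPt (v : Fin 5 → K) : Fin 5 → K := ![v 0, v 1, v 3, σ (v 2), σ (v 4)]

/-- The line of the affine hexagon given by a vertex of its polarity quotient. -/
def hexLn (v : Fin 5 → K) : Fin 5 → K := ![σ (v 0), v 2, v 4, σ (v 1), σ (v 3)]

/-- The point of `v` lies on the line of `w`. -/
def HexRel (v w : Fin 5 → K) : Prop := HexInc (hexPt σ v) (hexLn σ w)

/-- The vertex related to `v` with first coordinate `a`. -/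
def hexNb (v : Fin 5 → K) (a : K) : Fin 5 → K :=
  ![a, a * σ (v 0) - v 2, v 0 * σ a - v 1, a ^ 2 * σ (v 0) - v 4, v 0 ^ 2 * σ a - v 3]

/-- The self-related vertices. -/
def hexAbs (c : K × K × K) : Fin 5 → K :=
  ![c.1, c.2.1, c.1 * σ c.1 - c.2.1, c.2.2, c.1 ^ 2 * σ c.1 - c.2.2]

variable {σ}

/-- Two of the incidence equations are σ-images. Removing σ shows that the relation is symmetric,
i.e. comes from a polarity. -/
theorem hexRel_iff (hσ : ∀ x, σ (σ x) = x ^ 3) {v w : Fin 5 → K} :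
    HexRel σ v w ↔ v 1 + w 2 = v 0 * σ (w 0) ∧ v 3 + w 4 = v 0 ^ 2 * σ (w 0) ∧
      w 1 + v 2 = w 0 * σ (v 0) ∧ w 3 + v 4 = w 0 ^ 2 * σ (v 0) := by
  have e1 : σ (w 1 + v 2) = σ (w 0 * σ (v 0)) ↔ w 1 + v 2 = w 0 * σ (v 0) :=
    σ.injective.eq_iff
  have e2 : σ (w 3 + v 4) = σ (w 0 ^ 2 * σ (v 0)) ↔ w 3 + v 4 = w 0 ^ 2 * σ (v 0) :=
    σ.injective.eq_iff
  rw [← e1, ← e2]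
  simp only [HexRel, HexInc, hexPt, hexLn, Matrix.cons_val, map_add, map_mul, map_pow, hσ]
  rw [add_comm (σ (w 1)), add_comm (σ (w 3)), mul_comm (σ (w 0)), mul_comm (σ (w 0) ^ 2)]

theorem HexRel.symm (hσ : ∀ x, σ (σ x) = x ^ 3) {v w : Fin 5 → K} (h : HexRel σ v w) :
    HexRel σ w v := by
  rw [hexRel_iff hσ] at h ⊢
  exact ⟨h.2.2.1, h.2.2.2, h.1, h.2.1⟩

theorem hexRel_hexNb (hσ : ∀ x, σ (σ x) = x ^ 3) (v : Fin 5 → K) (a : K) :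
    HexRel σ v (hexNb σ v a) := by
  rw [hexRel_iff hσ]
  simp [hexNb]

theorem HexRel.eq_hexNb (hσ : ∀ x, σ (σ x) = x ^ 3) {v w : Fin 5 → K} (h : HexRel σ v w) :
    w = hexNb σ v (w 0) := by
  rw [hexRel_iff hσ] at h
  obtain ⟨h1, h2, h3, h4⟩ := h
  ext i
  fin_cases i
  · simp [hexNb]
  · simpa [hexNb] using eq_sub_of_add_eq h3
  · simpa [hexNb] using eq_sub_of_add_eq' h1
  · simpa [hexNb] using eq_sub_of_add_eq h4
  · simpa [hexNb] using eq_sub_of_add_eq' h2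

theorem HexRel.zero_ne (hσ : ∀ x, σ (σ x) = x ^ 3) {v w w' : Fin 5 → K} (h : HexRel σ v w)
    (h' : HexRel σ v w') (hne : w ≠ w') : w 0 ≠ w' 0 := by
  intro h0
  apply hne
  rw [h.eq_hexNb hσ, h'.eq_hexNb hσ, h0]

theorem HexRel.hexPt_ne (hσ : ∀ x, σ (σ x) = x ^ 3) {v w w' : Fin 5 → K} (h : HexRel σ v w)
    (h' : HexRel σ v w') (hne : w ≠ w') : hexPt σ w 0 ≠ hexPt σ w' 0 :=
  show w 0 ≠ w' 0 from h.zero_ne hσ h' hne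

theorem HexRel.hexLn_ne (hσ : ∀ x, σ (σ x) = x ^ 3) {v w w' : Fin 5 → K} (h : HexRel σ v w)
    (h' : HexRel σ v w') (hne : w ≠ w') : hexLn σ w 0 ≠ hexLn σ w' 0 :=
  fun h0 => h.zero_ne hσ h' hne (σ.injective h0)

theorem hexRel_hexAbs (hσ : ∀ x, σ (σ x) = x ^ 3) (c : K × K × K) :
    HexRel σ (hexAbs σ c) (hexAbs σ c) := by
  rw [hexRel_iff hσ]
  simp [hexAbs]

theorem three_eq_zero_of_charP [CharP K 3] : (3 : K) = 0 := by
  exact_mod_cast CharP.cast_eq_zero K 3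

section NoClosedWalks

variable (hσ : ∀ x, σ (σ x) = x ^ 3) {v₀ v₁ v₂ v₃ v₄ v₅ v₆ v₇ v₈ v₉ : Fin 5 → K}

include hσ

/-- A closed walk of even length is read alternately as points and lines of the hexagon. Consecutive
vertices may be equal, so loops at self-related vertices are covered; this is used for the centres
below. -/
theorem HexRel.no_closed_four (h₀ : HexRel σ v₀ v₁) (h₁ : HexRel σ v₁ v₂) (h₂ : HexRel σ v₂ v₃)
    (h₃ : HexRel σ v₃ v₀) (n₀ : v₀ ≠ v₂) (n₁ : v₁ ≠ v₃) : False :=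
  HexInc.no_cycle_four h₀ (h₁.symm hσ) h₂ (h₃.symm hσ) ((h₀.symm hσ).hexPt_ne hσ h₁ n₀)
    ((h₁.symm hσ).hexLn_ne hσ h₂ n₁)

theorem HexRel.no_closed_six (h₀ : HexRel σ v₀ v₁) (h₁ : HexRel σ v₁ v₂) (h₂ : HexRel σ v₂ v₃)
    (h₃ : HexRel σ v₃ v₄) (h₄ : HexRel σ v₄ v₅) (h₅ : HexRel σ v₅ v₀) (n₀ : v₀ ≠ v₂)
    (n₁ : v₀ ≠ v₄) (n₂ : v₁ ≠ v₅) : False :=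
  HexInc.no_cycle_six h₀ (h₁.symm hσ) h₂ (h₃.symm hσ) h₄ (h₅.symm hσ)
    ((h₀.symm hσ).hexPt_ne hσ h₁ n₀) (h₅.hexPt_ne hσ (h₄.symm hσ) n₁)
    (h₀.hexLn_ne hσ (h₅.symm hσ) n₂)

theorem HexRel.no_closed_eight [CharP K 3] (h₀ : HexRel σ v₀ v₁) (h₁ : HexRel σ v₁ v₂)
    (h₂ : HexRel σ v₂ v₃) (h₃ : HexRel σ v₃ v₄) (h₄ : HexRel σ v₄ v₅) (h₅ : HexRel σ v₅ v₆)
    (h₆ : HexRel σ v₆ v₇) (h₇ : HexRel σ v₇ v₀) (n₀ : v₀ ≠ v₂) (n₁ : v₂ ≠ v₄) (n₂ : v₀ ≠ v₆)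
    (n₃ : v₁ ≠ v₃) (n₄ : v₁ ≠ v₇) : False :=
  HexInc.no_cycle_eight three_eq_zero_of_charP h₀ (h₁.symm hσ) h₂ (h₃.symm hσ) h₄
    (h₅.symm hσ) h₆ (h₇.symm hσ)
    ((h₀.symm hσ).hexPt_ne hσ h₁ n₀) ((h₂.symm hσ).hexPt_ne hσ h₃ n₁)
    (h₇.hexPt_ne hσ (h₆.symm hσ) n₂) ((h₁.symm hσ).hexLn_ne hσ h₂ n₃)
    (h₀.hexLn_ne hσ (h₇.symm hσ) n₄)

theorem HexRel.no_closed_ten [CharP K 3] (h₀ : HexRel σ v₀ v₁) (h₁ : HexRel σ v₁ v₂) (h₂ : HexRel σ v₂ v₃)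
    (h₃ : HexRel σ v₃ v₄) (h₄ : HexRel σ v₄ v₅) (h₅ : HexRel σ v₅ v₆) (h₆ : HexRel σ v₆ v₇)
    (h₇ : HexRel σ v₇ v₈) (h₈ : HexRel σ v₈ v₉) (h₉ : HexRel σ v₉ v₀) (n₀ : v₀ ≠ v₂)
    (n₁ : v₂ ≠ v₄) (n₂ : v₄ ≠ v₆) (n₃ : v₁ ≠ v₃) (n₄ : v₃ ≠ v₅) : False :=
  HexInc.no_cycle_ten three_eq_zero_of_charP h₀ (h₁.symm hσ) h₂ (h₃.symm hσ) h₄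
    (h₅.symm hσ) h₆ (h₇.symm hσ) h₈ (h₉.symm hσ)
    ((h₀.symm hσ).hexPt_ne hσ h₁ n₀) ((h₂.symm hσ).hexPt_ne hσ h₃ n₁)
    ((h₄.symm hσ).hexPt_ne hσ h₅ n₂) ((h₁.symm hσ).hexLn_ne hσ h₂ n₃)
    ((h₃.symm hσ).hexLn_ne hσ h₄ n₄)

end NoClosedWalks

section Centres

variable (hσ : ∀ x, σ (σ x) = x ^ 3) {v w a b c : Fin 5 → K}

include hσ

/-- A walk of length j from `v` to `w`, the loop at `w`, the way back and the loop at `v` form a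
closed walk of length 2j + 2. The lengths j = 1, 2, 3, 4 correspond to 4, 6, 8, 10. -/
theorem HexRel.not_of_self (hv : HexRel σ v v) (hw : HexRel σ w w) (hne : v ≠ w) :
    ¬ HexRel σ v w := fun h =>
  HexRel.no_closed_four hσ hv h hw (h.symm hσ) hne hne

theorem HexRel.not_two_of_self (hv : HexRel σ v v) (hw : HexRel σ w w) (hne : v ≠ w)
    (h₁ : HexRel σ v a) (h₂ : HexRel σ a w) : False := by
  by_cases hav : a = v
  · exact hv.not_of_self hσ hw hne (hav ▸ h₂)
  · exact HexRel.no_closed_six hσ h₁ h₂ hw (h₂.symm hσ) (h₁.symm hσ) hv hne (Ne.symm hav) hav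

theorem HexRel.not_three_of_self [CharP K 3] (hv : HexRel σ v v) (hw : HexRel σ w w) (hne : v ≠ w)
    (h₁ : HexRel σ v a) (h₂ : HexRel σ a b) (h₃ : HexRel σ b w) : False := by
  by_cases hav : a = v
  · exact hv.not_two_of_self hσ hw hne (hav ▸ h₂) h₃
  by_cases hbw : b = w
  · exact hv.not_two_of_self hσ hw hne h₁ (hbw ▸ h₂)
  by_cases haw : a = w
  · exact hv.not_of_self hσ hw hne (haw ▸ h₁)
  by_cases hbv : b = v
  · exact hv.not_of_self hσ hw hne (hbv ▸ h₃)
  exact HexRel.no_closed_eight hσ h₁ h₂ h₃ hw (h₃.symm hσ) (h₂.symm hσ) (h₁.symm hσ) hv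
    (Ne.symm hbv) hbw (Ne.symm hav) haw hav

theorem HexRel.not_four_of_self [CharP K 3] (hv : HexRel σ v v) (hw : HexRel σ w w) (hne : v ≠ w)
    (h₁ : HexRel σ v a) (h₂ : HexRel σ a b) (h₃ : HexRel σ b c) (h₄ : HexRel σ c w) : False := by
  by_cases hcw : c = w
  · exact hv.not_three_of_self hσ hw hne h₁ h₂ (hcw ▸ h₃)
  by_cases hbv : b = v
  · exact hv.not_two_of_self hσ hw hne (hbv ▸ h₃) h₄
  by_cases hbw : b = w
  · exact hv.not_two_of_self hσ hw hne h₁ (hbw ▸ h₂)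
  by_cases hac : a = c
  · exact hv.not_two_of_self hσ hw hne h₁ (hac ▸ h₄)
  exact HexRel.no_closed_ten hσ h₁ h₂ h₃ h₄ hw (h₄.symm hσ) (h₃.symm hσ) (h₂.symm hσ)
    (h₁.symm hσ) hv (Ne.symm hbv) hbw (Ne.symm hcw) hac hcw

end Centres

/-- The polarity graph of the affine hexagon. -/
def hexGraph (hσ : ∀ x, σ (σ x) = x ^ 3) : SimpleGraph (Fin 5 → K) where
  Adj v w := v ≠ w ∧ HexRel σ v w
  symm := ⟨fun _ _ h => ⟨h.1.symm, h.2.symm hσ⟩⟩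
  loopless := ⟨fun _ h => h.1 rfl⟩

open CompletePartition in
theorem familyFree_hexGraph [CharP K 3] (hσ : ∀ x, σ (σ x) = x ^ 3) :
    FamilyFree {C 4, C 6, C 8, C 10} (hexGraph hσ) := by
  intro H hH hc
  simp only [Set.mem_insert_iff, Set.mem_singleton_iff] at hH
  rcases hH with rfl | rfl | rfl | rfl
  · obtain ⟨f, hinj, hadj, hlast⟩ := (cycleGraph_isContained_iff_exists_nat (by norm_num)).1 hc
    have hr : ∀ i, i + 1 < 4 → HexRel σ (f i) (f (i + 1)) := fun i hi => (hadj i hi).2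
    have hn : ∀ i < 4, ∀ j < 4, i ≠ j → f i ≠ f j := fun i hi j hj hij h =>
      hij (hinj i hi j hj h)
    exact HexRel.no_closed_four hσ (hr 0 (by norm_num)) (hr 1 (by norm_num)) (hr 2 (by norm_num))
      hlast.2 (hn _ (by norm_num) _ (by norm_num) (by norm_num))
      (hn _ (by norm_num) _ (by norm_num) (by norm_num))
  · obtain ⟨f, hinj, hadj, hlast⟩ := (cycleGraph_isContained_iff_exists_nat (by norm_num)).1 hc
    have hr : ∀ i, i + 1 < 6 → HexRel σ (f i) (f (i + 1)) := fun i hi => (hadj i hi).2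
    have hn : ∀ i < 6, ∀ j < 6, i ≠ j → f i ≠ f j := fun i hi j hj hij h =>
      hij (hinj i hi j hj h)
    exact HexRel.no_closed_six hσ (hr 0 (by norm_num)) (hr 1 (by norm_num)) (hr 2 (by norm_num))
      (hr 3 (by norm_num)) (hr 4 (by norm_num))
      hlast.2 (hn _ (by norm_num) _ (by norm_num) (by norm_num))
      (hn _ (by norm_num) _ (by norm_num) (by norm_num))
      (hn _ (by norm_num) _ (by norm_num) (by norm_num))
  · obtain ⟨f, hinj, hadj, hlast⟩ := (cycleGraph_isContained_iff_exists_nat (by norm_num)).1 hc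
    have hr : ∀ i, i + 1 < 8 → HexRel σ (f i) (f (i + 1)) := fun i hi => (hadj i hi).2
    have hn : ∀ i < 8, ∀ j < 8, i ≠ j → f i ≠ f j := fun i hi j hj hij h =>
      hij (hinj i hi j hj h)
    exact HexRel.no_closed_eight hσ (hr 0 (by norm_num)) (hr 1 (by norm_num)) (hr 2 (by norm_num))
      (hr 3 (by norm_num)) (hr 4 (by norm_num)) (hr 5 (by norm_num)) (hr 6 (by norm_num))
      hlast.2 (hn _ (by norm_num) _ (by norm_num) (by norm_num))
      (hn _ (by norm_num) _ (by norm_num) (by norm_num))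
      (hn _ (by norm_num) _ (by norm_num) (by norm_num))
      (hn _ (by norm_num) _ (by norm_num) (by norm_num))
      (hn _ (by norm_num) _ (by norm_num) (by norm_num))
  · obtain ⟨f, hinj, hadj, hlast⟩ := (cycleGraph_isContained_iff_exists_nat (by norm_num)).1 hc
    have hr : ∀ i, i + 1 < 10 → HexRel σ (f i) (f (i + 1)) := fun i hi => (hadj i hi).2
    have hn : ∀ i < 10, ∀ j < 10, i ≠ j → f i ≠ f j := fun i hi j hj hij h =>
      hij (hinj i hi j hj h)
    exact HexRel.no_closed_ten hσ (hr 0 (by norm_num)) (hr 1 (by norm_num)) (hr 2 (by norm_num))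
      (hr 3 (by norm_num)) (hr 4 (by norm_num)) (hr 5 (by norm_num)) (hr 6 (by norm_num))
      (hr 7 (by norm_num)) (hr 8 (by norm_num))
      hlast.2 (hn _ (by norm_num) _ (by norm_num) (by norm_num))
      (hn _ (by norm_num) _ (by norm_num) (by norm_num))
      (hn _ (by norm_num) _ (by norm_num) (by norm_num))
      (hn _ (by norm_num) _ (by norm_num) (by norm_num))
      (hn _ (by norm_num) _ (by norm_num) (by norm_num))

theorem hexAbs_injective : Function.Injective (hexAbs σ) := by
  rintro ⟨a, p, r⟩ ⟨a', p', r'⟩ h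
  have h0 := congrFun h 0
  have h1 := congrFun h 1
  have h3 := congrFun h 3
  simp only [hexAbs, Matrix.cons_val] at h0 h1 h3
  rw [h0, h1, h3]

variable [Fintype K] [DecidableEq K]

variable (σ) in
/-- The vertices within distance two of a self-related vertex. -/
def hexPart (c : K × K × K) : Finset (Fin 5 → K) :=
  univ.image fun x : K × K => hexNb σ (hexNb σ (hexAbs σ c) x.1) x.2

theorem mem_hexPart (hσ : ∀ x, σ (σ x) = x ^ 3) {c : K × K × K} {x : Fin 5 → K} :
    x ∈ hexPart σ c ↔ ∃ z, HexRel σ (hexAbs σ c) z ∧ HexRel σ z x := by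
  simp only [hexPart, mem_image, mem_univ, true_and, Prod.exists]
  constructor
  · rintro ⟨a, b, rfl⟩
    exact ⟨_, hexRel_hexNb hσ _ _, hexRel_hexNb hσ _ _⟩
  · rintro ⟨z, h1, h2⟩
    exact ⟨z 0, x 0, by rw [← h1.eq_hexNb hσ, ← h2.eq_hexNb hσ]⟩

theorem card_hexPart_le (c : K × K × K) : (hexPart σ c).card ≤ Fintype.card K ^ 2 := by
  refine card_image_le.trans_eq ?_
  rw [card_univ, Fintype.card_prod, sq]

/-- A common vertex would give a walk of length four between two self-related vertices. -/
theorem disjoint_hexPart [CharP K 3] (hσ : ∀ x, σ (σ x) = x ^ 3) {c c' : K × K × K} (hcc : c ≠ c') :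
    Disjoint (hexPart σ c) (hexPart σ c') := by
  rw [Finset.disjoint_left]
  intro x hx hx'
  obtain ⟨z, h1, h2⟩ := (mem_hexPart hσ).1 hx
  obtain ⟨z', h1', h2'⟩ := (mem_hexPart hσ).1 hx'
  exact (hexRel_hexAbs hσ c).not_four_of_self hσ (hexRel_hexAbs hσ c')
    (fun h => hcc (hexAbs_injective h)) h1 h2 (h2'.symm hσ) (h1'.symm hσ)

/-- Generic parts are joined by an edge. -/
theorem exists_adj_hexPart [CharP K 3] (hσ : ∀ x, σ (σ x) = x ^ 3) {c c' : K × K × K} (hcc : c ≠ c')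
    {k : Fin 4 → K} (hk : k = hexShift (hexPt σ (hexAbs σ c)) (hexLn σ (hexAbs σ c')))
    (hdet : hexDet k ≠ 0)
    (hu : k 2 * k 3 + k 1 ^ 3 ≠ 0) (hβ : k 0 * k 1 + k 3 ≠ 0)
    (hw : k 2 * k 3 ^ 2 - k 3 * k 1 ^ 3 + k 0 ^ 3 * k 2 ^ 2 ≠ 0) :
    ∃ x ∈ hexPart σ c, ∃ y ∈ hexPart σ c', (hexGraph hσ).Adj x y := by
  have h3 := three_eq_zero_of_charP (K := K)
  obtain ⟨u, w, y, z, h⟩ := exists_hexPath h3 hdet hu hβ hw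
  have hsurj : Function.Surjective σ := Finite.surjective_of_injective σ.injective
  -- Along the walk from `c` to `c'` the vertices v₁ and v₃ act as lines, whose first coordinate
  -- carries a σ, and v₂ and v₄ as points. The middle edge v₂v₃ joins the two balls.
  obtain ⟨a₁, ha₁⟩ := hsurj (y + σ c'.1)
  obtain ⟨a₃, ha₃⟩ := hsurj (z + σ c'.1)
  set v₁ := hexNb σ (hexAbs σ c) a₁ with hv₁
  set v₂ := hexNb σ v₁ (c.1 + u) with hv₂
  set v₃ := hexNb σ v₂ a₃ with hv₃
  set v₄ := hexNb σ v₃ (c.1 + u - w) with hv₄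
  have r1 : HexRel σ (hexAbs σ c) v₁ := hexRel_hexNb hσ _ _
  have r2 : HexRel σ v₁ v₂ := hexRel_hexNb hσ _ _
  have r3 : HexRel σ v₂ v₃ := hexRel_hexNb hσ _ _
  have r4 : HexRel σ v₃ v₄ := hexRel_hexNb hσ _ _
  have r5 : HexRel σ v₄ (hexAbs σ c') := by
    refine HexInc.of_hexPath h3 r1 (r2.symm hσ) r3 (r4.symm hσ) ?_
    rw [← hk]
    have e0 : hexPt σ (hexAbs σ c) 0 = c.1 := rfl
    have e1 : hexLn σ v₁ 0 = y + σ c'.1 := ha₁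
    have e2 : hexPt σ v₂ 0 = c.1 + u := rfl
    have e3 : hexLn σ v₃ 0 = z + σ c'.1 := ha₃
    have e4 : hexPt σ v₄ 0 = c.1 + u - w := rfl
    have e5 : hexLn σ (hexAbs σ c') 0 = σ c'.1 := rfl
    rw [e0, e1, e2, e3, e4, e5]
    convert h using 1 <;> ring
  have m2 : v₂ ∈ hexPart σ c := (mem_hexPart hσ).2 ⟨v₁, r1, r2⟩
  have m3 : v₃ ∈ hexPart σ c' := (mem_hexPart hσ).2 ⟨v₄, r5.symm hσ, r4.symm hσ⟩
  refine ⟨v₂, m2, v₃, m3, ?_, r3⟩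
  intro h
  exact Finset.disjoint_left.1 (disjoint_hexPart hσ hcc) m2 (h ▸ m3)

end HexagonPolarity

/-! ### Counting the missing pairs for the hexagon -/

section HexagonParts

open Finset SimpleGraph CompletePartition

variable {K : Type*} [Field K] [Fintype K] [DecidableEq K] {σ : K →+* K}

theorem card_le_of_card_fibre_le {K : Type*} [Fintype K] [DecidableEq K] {n : ℕ} {P : K × K × K → Prop} [DecidablePred P]
    (g : K × K × K → K × K)
    (h : ∀ b, (univ.filter fun x => P x ∧ g x = b).card ≤ n) :
    (univ.filter P).card ≤ n * Fintype.card K ^ 2 := by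
  refine (card_le_mul_card_image_of_maps_to (f := g) (t := univ) (fun _ _ => mem_univ _) n
    fun b _ => ?_).trans_eq ?_
  · rw [filter_filter]
    exact h b
  · rw [card_univ, Fintype.card_prod, sq]

open Classical in
-- For c' = (a, p, r) the shifted coordinates k₀ and k₂ depend only on (a, p), while k₁ = A - r and
-- k₃ = B + σr. Each of k₀ = 0 and k₂ = 0 determines `p` from `a`; otherwise at most 18 values of
-- `r` are exceptional. Hence 20 = 1 + 1 + 18.
theorem card_filter_not_adj_hexPart_le [CharP K 3] (hσ : ∀ x, σ (σ x) = x ^ 3)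
    (c : K × K × K) :
    (univ.filter fun c' => c ≠ c' ∧ ∀ x ∈ hexPart σ c, ∀ y ∈ hexPart σ c',
      ¬ (hexGraph hσ).Adj x y).card ≤ 20 * Fintype.card K ^ 2 := by
  let v := hexAbs σ c
  let k₀ : K → K → K := fun a p => v 1 + (a * σ a - p) - v 0 * σ a
  let k₂ : K → K → K := fun a p => σ (v 2) + σ p - v 0 ^ 3 * σ a
  let A : K → K → K := fun a p =>
    v 3 + a ^ 2 * σ a - 2 * v 0 * (v 1 + (a * σ a - p)) + v 0 ^ 2 * σ a
  let B : K → K → K := fun a p => σ (v 4) - 2 * σ a * k₂ a p - v 0 ^ 3 * σ a ^ 2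
  let Q : K × K × K → Prop := fun c' =>
    (k₀ c'.1 c'.2.1 ≠ 0 ∧ k₂ c'.1 c'.2.1 ≠ 0) ∧
      (k₀ c'.1 c'.2.1 * (A c'.1 c'.2.1 - c'.2.2) + (B c'.1 c'.2.1 + σ c'.2.2) = 0 ∨
      k₂ c'.1 c'.2.1 * (B c'.1 c'.2.1 + σ c'.2.2) + (A c'.1 c'.2.1 - c'.2.2) ^ 3 = 0 ∨
      k₀ c'.1 c'.2.1 ^ 2 * k₂ c'.1 c'.2.1 + (A c'.1 c'.2.1 - c'.2.2) *
        (k₀ c'.1 c'.2.1 * (A c'.1 c'.2.1 - c'.2.2) - (B c'.1 c'.2.1 + σ c'.2.2)) = 0 ∨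
      k₂ c'.1 c'.2.1 * (B c'.1 c'.2.1 + σ c'.2.2) ^ 2 - (B c'.1 c'.2.1 + σ c'.2.2) *
        (A c'.1 c'.2.1 - c'.2.2) ^ 3 + k₀ c'.1 c'.2.1 ^ 3 * k₂ c'.1 c'.2.1 ^ 2 = 0)
  have h0 : (univ.filter fun c' : K × K × K => k₀ c'.1 c'.2.1 = 0).card ≤
      1 * Fintype.card K ^ 2 := by
    refine card_le_of_card_fibre_le (fun c' => (c'.1, c'.2.2)) fun b => ?_
    rw [card_le_one]
    rintro ⟨a, p, r⟩ h ⟨a', p', r'⟩ h'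
    simp only [mem_filter, mem_univ, true_and, k₀] at h h'
    obtain ⟨h, rfl⟩ := h
    simp only [Prod.mk.injEq] at h'
    obtain ⟨h', rfl, rfl⟩ := h'
    have : p = p' := by linear_combination h' - h
    rw [this]
  have h2 : (univ.filter fun c' : K × K × K => k₂ c'.1 c'.2.1 = 0).card ≤
      1 * Fintype.card K ^ 2 := by
    refine card_le_of_card_fibre_le (fun c' => (c'.1, c'.2.2)) fun b => ?_
    rw [card_le_one]
    rintro ⟨a, p, r⟩ h ⟨a', p', r'⟩ h'
    simp only [mem_filter, mem_univ, true_and, k₂] at h h'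
    obtain ⟨h, rfl⟩ := h
    simp only [Prod.mk.injEq] at h'
    obtain ⟨h', rfl, rfl⟩ := h'
    have : σ p = σ p' := by linear_combination h - h'
    rw [σ.injective this]
  have hQ : (univ.filter Q).card ≤ 18 * Fintype.card K ^ 2 := by
    refine card_le_of_card_fibre_le (fun c' => (c'.1, c'.2.1)) ?_
    rintro ⟨a, p⟩
    by_cases hap : k₀ a p ≠ 0 ∧ k₂ a p ≠ 0
    · refine (card_le_card_of_injOn (fun c' => c'.2.2) ?_ ?_).trans
        (card_hexPath_exceptions_le hσ hap.1 hap.2 (A a p) (B a p))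
      · rintro ⟨a', p', r'⟩ h
        simp only [coe_filter, mem_univ, true_and, Set.mem_ofPred_eq, Prod.mk.injEq, Q] at h ⊢
        obtain ⟨h, rfl, rfl⟩ := h
        exact h.2
      · rintro ⟨a', p', r'⟩ h ⟨a'', p'', r''⟩ h' heq
        simp only [coe_filter, mem_univ, true_and, Set.mem_ofPred_eq, Prod.mk.injEq] at h h' heq
        rw [h.2.1, h.2.2, h'.2.1, h'.2.2, heq]
    · rw [card_eq_zero.2]
      · exact Nat.zero_le _
      · rw [filter_eq_empty_iff]
        rintro ⟨a', p', r'⟩ - ⟨h, heq⟩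
        simp only [Prod.mk.injEq] at heq
        obtain ⟨rfl, rfl⟩ := heq
        exact hap h.1
  have hsub : (univ.filter fun c' => c ≠ c' ∧ ∀ x ∈ hexPart σ c, ∀ y ∈ hexPart σ c',
      ¬ (hexGraph hσ).Adj x y) ⊆ (univ.filter fun c' : K × K × K => k₀ c'.1 c'.2.1 = 0) ∪
        ((univ.filter fun c' : K × K × K => k₂ c'.1 c'.2.1 = 0) ∪ univ.filter Q) := by
    intro c' hc'
    obtain ⟨hne, hno⟩ := (mem_filter.1 hc').2
    simp only [mem_union, mem_filter, mem_univ, true_and]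
    by_contra! hcon
    obtain ⟨e0, e2, eQ⟩ := hcon
    have eQ' := not_and.1 eQ ⟨e0, e2⟩
    push Not at eQ'
    obtain ⟨q1, q2, q3, q4⟩ := eQ'
    obtain ⟨x, hx, y, hy, hxy⟩ := exists_adj_hexPart hσ hne
      (k := ![k₀ c'.1 c'.2.1, A c'.1 c'.2.1 - c'.2.2, k₂ c'.1 c'.2.1, B c'.1 c'.2.1 + σ c'.2.2])
      (by
        ext i
        fin_cases i
        · simp [hexShift, hexPt, hexLn, k₀, v, hexAbs]
        · simp [hexShift, hexPt, hexLn, A, v, hexAbs]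
          ring
        · simp [hexShift, hexPt, hexLn, k₂, v, hexAbs]
        · simp [hexShift, hexPt, hexLn, B, k₂, v, hexAbs]
          ring) q3 q2 q1 q4
    exact hno x hx y hy hxy
  refine (card_le_card hsub).trans ((card_union_le _ _).trans ?_)
  have := card_union_le (univ.filter fun c' : K × K × K => k₂ c'.1 c'.2.1 = 0) (univ.filter Q)
  omega

theorem exists_isRKGraph_of_hexagon [CharP K 3] (hσ : ∀ x, σ (σ x) = x ^ 3) {t s : ℕ} (ht : 0 < t)
    (hs : 20 * Fintype.card K ^ 2 / t + (t + 1) ^ 10 < s) :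
    ∃ (n : ℕ) (G : SimpleGraph (Fin n)), FamilyFree {C 4, C 6, C 8, C 10} G ∧
      IsRKGraph G (Fintype.card K ^ 3) (Fintype.card K ^ 2 + s) := by
  classical
  have := exists_isRKGraph_of_few_missing (G := hexGraph hσ) (L := 10) (by
      intro H hH
      simp only [Set.mem_insert_iff, Set.mem_singleton_iff] at hH
      rcases hH with rfl | rfl | rfl | rfl
      exacts [⟨4, by norm_num⟩, ⟨6, by norm_num⟩, ⟨8, by norm_num⟩, ⟨10, by norm_num⟩])
    (familyFree_hexGraph hσ) (hexPart σ) (fun i j hij => disjoint_hexPart hσ hij)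
    (fun i => univ_nonempty.image _) card_hexPart_le
    (fun i => le_trans (le_of_eq (by congr)) (card_filter_not_adj_hexPart_le hσ i)) ht hs
  rwa [Fintype.card_prod, Fintype.card_prod, show Fintype.card K * (Fintype.card K *
    Fintype.card K) = Fintype.card K ^ 3 by ring] at this

end HexagonParts

/-! ### The polarity graph of the symplectic quadrangle -/

section QuadranglePolarity

open Finset SimpleGraph CompletePartition

variable {K : Type*} [Field K] (σ : K →+* K)

/-- The relation which a polarity of the affine symplectic quadrangle induces on its points. -/
def QuadRel (v w : Fin 3 → K) : Prop :=
  v 1 + w 2 = v 0 ^ 2 * σ (w 0) ∧ w 1 + v 2 = w 0 ^ 2 * σ (v 0)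

/-- The vertex related to `v` with first coordinate `a`. -/
def quadNb (v : Fin 3 → K) (a : K) : Fin 3 → K :=
  ![a, a ^ 2 * σ (v 0) - v 2, v 0 ^ 2 * σ a - v 1]

/-- The self-related vertices. -/
def quadAbs (c : K × K) : Fin 3 → K := ![c.1, c.2, c.1 ^ 2 * σ c.1 - c.2]

variable {σ}

theorem QuadRel.symm {v w : Fin 3 → K} (h : QuadRel σ v w) : QuadRel σ w v := ⟨h.2, h.1⟩

theorem quadRel_quadNb (v : Fin 3 → K) (a : K) : QuadRel σ v (quadNb σ v a) := by
  simp [QuadRel, quadNb]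

theorem QuadRel.eq_quadNb {v w : Fin 3 → K} (h : QuadRel σ v w) : w = quadNb σ v (w 0) := by
  ext i
  fin_cases i
  · simp [quadNb]
  · simpa [quadNb] using eq_sub_of_add_eq h.2
  · simpa [quadNb] using eq_sub_of_add_eq' h.1

theorem QuadRel.zero_ne {v w w' : Fin 3 → K} (h : QuadRel σ v w) (h' : QuadRel σ v w')
    (hne : w ≠ w') : w 0 ≠ w' 0 := by
  intro h0
  apply hne
  rw [h.eq_quadNb, h'.eq_quadNb, h0]

theorem quadRel_quadAbs (c : K × K) : QuadRel σ (quadAbs σ c) (quadAbs σ c) := by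
  simp [QuadRel, quadAbs]

theorem quadAbs_injective : Function.Injective (quadAbs σ) := by
  rintro ⟨a, p⟩ ⟨a', p'⟩ h
  have h0 := congrFun h 0
  have h1 := congrFun h 1
  simp only [quadAbs, Matrix.cons_val] at h0 h1
  rw [h0, h1]

theorem two_eq_zero_of_charP [CharP K 2] : (2 : K) = 0 := by
  exact_mod_cast CharP.cast_eq_zero K 2

/-- Since squaring is additive in characteristic two, this supplies the relation for xy, with x = v₀
and y = σ(w₀), alongside the one for x²y in the definition. The elimination used for the hexagon
then applies. -/
theorem QuadRel.map_twist (hσ : ∀ x, σ (σ x) = x ^ 2) {v w : Fin 3 → K} (h : QuadRel σ v w) :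
    σ (w 1) + σ (v 2) = (v 0 * σ (w 0)) ^ 2 := by
  rw [← map_add, h.2, map_mul, map_pow, hσ]
  ring

section NoClosedWalks

variable [CharP K 2] {v₀ v₁ v₂ v₃ v₄ v₅ : Fin 3 → K}

theorem QuadRel.no_closed_four (hσ : ∀ x, σ (σ x) = x ^ 2) (h₀ : QuadRel σ v₀ v₁)
    (h₁ : QuadRel σ v₁ v₂) (h₂ : QuadRel σ v₂ v₃)
    (h₃ : QuadRel σ v₃ v₀) (n₀ : v₀ ≠ v₂) (n₁ : v₁ ≠ v₃) : False := by
  have e : (v₀ 0 * σ (v₁ 0) - v₂ 0 * σ (v₁ 0) + v₂ 0 * σ (v₃ 0) - v₀ 0 * σ (v₃ 0)) ^ 2 = 0 := by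
    have hs : (v₀ 0 * σ (v₁ 0)) ^ 2 - (v₂ 0 * σ (v₁ 0)) ^ 2 + (v₂ 0 * σ (v₃ 0)) ^ 2 -
        (v₀ 0 * σ (v₃ 0)) ^ 2 = 0 := by
      linear_combination -h₀.map_twist hσ + h₁.symm.map_twist hσ - h₂.map_twist hσ +
        h₃.symm.map_twist hσ
    simp only [CharTwo.sub_eq_add, CharTwo.add_sq] at hs ⊢
    exact hs
  have e' : (v₀ 0 - v₂ 0) * (σ (v₁ 0) - σ (v₃ 0)) = 0 := by
    linear_combination pow_eq_zero_iff two_ne_zero |>.1 e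
  rcases mul_eq_zero.1 e' with h | h
  · exact h₀.symm.zero_ne h₁ n₀ (sub_eq_zero.1 h)
  · exact h₁.symm.zero_ne h₂ n₁ (σ.injective (sub_eq_zero.1 h))

theorem QuadRel.no_closed_six (hσ : ∀ x, σ (σ x) = x ^ 2) (h₀ : QuadRel σ v₀ v₁)
    (h₁ : QuadRel σ v₁ v₂) (h₂ : QuadRel σ v₂ v₃)
    (h₃ : QuadRel σ v₃ v₄) (h₄ : QuadRel σ v₄ v₅) (h₅ : QuadRel σ v₅ v₀) (n₀ : v₀ ≠ v₂)
    (n₁ : v₀ ≠ v₄) (n₂ : v₁ ≠ v₅) : False := by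
  obtain ⟨t₁, e₁⟩ : ∃ t, t = v₀ 0 * σ (v₁ 0) := ⟨_, rfl⟩
  obtain ⟨t₂, e₂⟩ : ∃ t, t = v₂ 0 * σ (v₁ 0) := ⟨_, rfl⟩
  obtain ⟨t₃, e₃⟩ : ∃ t, t = v₂ 0 * σ (v₃ 0) := ⟨_, rfl⟩
  obtain ⟨t₄, e₄⟩ : ∃ t, t = v₄ 0 * σ (v₃ 0) := ⟨_, rfl⟩
  obtain ⟨t₅, e₅⟩ : ∃ t, t = v₄ 0 * σ (v₅ 0) := ⟨_, rfl⟩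
  obtain ⟨t₆, e₆⟩ : ∃ t, t = v₀ 0 * σ (v₅ 0) := ⟨_, rfl⟩
  have m₁ := h₀.map_twist hσ
  have m₂ := h₁.symm.map_twist hσ
  have m₃ := h₂.map_twist hσ
  have m₄ := h₃.symm.map_twist hσ
  have m₅ := h₄.map_twist hσ
  have m₆ := h₅.symm.map_twist hσ
  rw [← e₁] at m₁
  rw [← e₂] at m₂
  rw [← e₃] at m₃
  rw [← e₄] at m₄
  rw [← e₅] at m₅
  rw [← e₆] at m₆
  have e : (t₁ - t₂ + t₃ - t₄ + t₅ - t₆) ^ 2 = 0 := by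
    have hs : t₁ ^ 2 - t₂ ^ 2 + t₃ ^ 2 - t₄ ^ 2 + t₅ ^ 2 - t₆ ^ 2 = 0 := by
      linear_combination -m₁ + m₂ - m₃ + m₄ - m₅ + m₆
    simp only [CharTwo.sub_eq_add, CharTwo.add_sq] at hs ⊢
    exact hs
  have e' := pow_eq_zero_iff two_ne_zero |>.1 e
  rw [e₁, e₂, e₃, e₄, e₅, e₆] at e'
  have f : (σ (v₁ 0) - σ (v₅ 0)) * ((v₀ 0 - v₂ 0) * (v₀ 0 - v₄ 0)) = 0 := by
    linear_combination -h₀.1 + h₁.2 - h₂.1 + h₃.2 - h₄.1 + h₅.2 - (v₂ 0 + v₄ 0) * e'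
  rcases mul_eq_zero.1 f with h | h
  · exact h₀.zero_ne h₅.symm n₂ (σ.injective (sub_eq_zero.1 h))
  rcases mul_eq_zero.1 h with h | h
  · exact h₀.symm.zero_ne h₁ n₀ (sub_eq_zero.1 h)
  · exact h₅.zero_ne h₄.symm n₁ (sub_eq_zero.1 h)

theorem QuadRel.not_of_self (hσ : ∀ x, σ (σ x) = x ^ 2) {v w : Fin 3 → K} (hv : QuadRel σ v v)
    (hw : QuadRel σ w w) (hne : v ≠ w) : ¬ QuadRel σ v w := fun h =>
  QuadRel.no_closed_four hσ hv h hw h.symm hne hne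

theorem QuadRel.not_two_of_self (hσ : ∀ x, σ (σ x) = x ^ 2) {v w a : Fin 3 → K}
    (hv : QuadRel σ v v) (hw : QuadRel σ w w) (hne : v ≠ w)
    (h₁ : QuadRel σ v a) (h₂ : QuadRel σ a w) : False := by
  by_cases hav : a = v
  · exact hv.not_of_self hσ hw hne (hav ▸ h₂)
  · exact QuadRel.no_closed_six hσ h₁ h₂ hw h₂.symm h₁.symm hv hne (Ne.symm hav) hav

end NoClosedWalks

variable (σ) in
/-- The polarity graph of the affine quadrangle. -/
def quadGraph : SimpleGraph (Fin 3 → K) where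
  Adj v w := v ≠ w ∧ QuadRel σ v w
  symm := ⟨fun _ _ h => ⟨h.1.symm, h.2.symm⟩⟩
  loopless := ⟨fun _ h => h.1 rfl⟩

theorem familyFree_quadGraph [CharP K 2] (hσ : ∀ x, σ (σ x) = x ^ 2) :
    FamilyFree {C 4, C 6} (quadGraph σ) := by
  intro H hH hc
  simp only [Set.mem_insert_iff, Set.mem_singleton_iff] at hH
  rcases hH with rfl | rfl
  · obtain ⟨f, hinj, hadj, hlast⟩ := (cycleGraph_isContained_iff_exists_nat (by norm_num)).1 hc
    have hr : ∀ i, i + 1 < 4 → QuadRel σ (f i) (f (i + 1)) := fun i hi => (hadj i hi).2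
    have hn : ∀ i < 4, ∀ j < 4, i ≠ j → f i ≠ f j := fun i hi j hj hij h =>
      hij (hinj i hi j hj h)
    exact QuadRel.no_closed_four hσ (hr 0 (by norm_num)) (hr 1 (by norm_num)) (hr 2 (by norm_num))
      hlast.2 (hn _ (by norm_num) _ (by norm_num) (by norm_num))
      (hn _ (by norm_num) _ (by norm_num) (by norm_num))
  · obtain ⟨f, hinj, hadj, hlast⟩ := (cycleGraph_isContained_iff_exists_nat (by norm_num)).1 hc
    have hr : ∀ i, i + 1 < 6 → QuadRel σ (f i) (f (i + 1)) := fun i hi => (hadj i hi).2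
    have hn : ∀ i < 6, ∀ j < 6, i ≠ j → f i ≠ f j := fun i hi j hj hij h =>
      hij (hinj i hi j hj h)
    exact QuadRel.no_closed_six hσ (hr 0 (by norm_num)) (hr 1 (by norm_num)) (hr 2 (by norm_num))
      (hr 3 (by norm_num)) (hr 4 (by norm_num))
      hlast.2 (hn _ (by norm_num) _ (by norm_num) (by norm_num))
      (hn _ (by norm_num) _ (by norm_num) (by norm_num))
      (hn _ (by norm_num) _ (by norm_num) (by norm_num))

variable [Fintype K] [DecidableEq K]

variable (σ) in
/-- The vertices related to a self-related vertex. -/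
def quadPart (c : K × K) : Finset (Fin 3 → K) := univ.image (quadNb σ (quadAbs σ c))

theorem mem_quadPart {c : K × K} {x : Fin 3 → K} :
    x ∈ quadPart σ c ↔ QuadRel σ (quadAbs σ c) x := by
  simp only [quadPart, mem_image, mem_univ, true_and]
  constructor
  · rintro ⟨a, rfl⟩
    exact quadRel_quadNb _ _
  · intro h
    exact ⟨x 0, h.eq_quadNb.symm⟩

theorem disjoint_quadPart [CharP K 2] (hσ : ∀ x, σ (σ x) = x ^ 2) {c c' : K × K} (hcc : c ≠ c') :
    Disjoint (quadPart σ c) (quadPart σ c') := by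
  rw [Finset.disjoint_left]
  intro x hx hx'
  rw [mem_quadPart] at hx hx'
  exact (quadRel_quadAbs c).not_two_of_self hσ (quadRel_quadAbs c')
    (fun h => hcc (quadAbs_injective h)) hx hx'.symm

/-- Generic parts are joined by an edge. -/
theorem exists_adj_quadPart [CharP K 2] (hσ : ∀ x, σ (σ x) = x ^ 2) {c c' : K × K} (hcc : c ≠ c')
    (hk : c.1 ^ 2 * σ c.1 - c.2 + c'.2 + c'.1 ^ 2 * σ c.1 ≠ 0)
    (hk' : c'.1 ^ 2 * σ c'.1 - c'.2 + c.2 + c.1 ^ 2 * σ c'.1 ≠ 0) :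
    ∃ x ∈ quadPart σ c, ∃ y ∈ quadPart σ c', (quadGraph σ).Adj x y := by
  have h2 := two_eq_zero_of_charP (K := K)
  have hsurj : Function.Surjective σ := Finite.surjective_of_injective σ.injective
  have hsq : Function.Surjective (frobenius K 2) :=
    Finite.surjective_of_injective (frobenius K 2).injective
  set k := c.1 ^ 2 * σ c.1 - c.2 + c'.2 + c'.1 ^ 2 * σ c.1 with hkdef
  set k' := c'.1 ^ 2 * σ c'.1 - c'.2 + c.2 + c.1 ^ 2 * σ c'.1 with hkdef'
  -- Wanted are `A` and `B` with A²σ(B) = k and B²σ(A) = k'. With s² = k, the choice σ(A) = σ(k)/k'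
  -- and B = k'/σ(s) works.
  obtain ⟨s, hs⟩ := hsq k
  rw [frobenius_def] at hs
  have hs0 : σ s ≠ 0 := by
    rw [map_ne_zero]
    rintro rfl
    exact hk (by rw [← hs]; ring)
  obtain ⟨A, hA⟩ := hsurj (σ k / k')
  obtain ⟨B, hB⟩ : ∃ B, B = k' / σ s := ⟨_, rfl⟩
  have hsk : σ k = σ s ^ 2 := by rw [← hs, map_pow]
  have e' : B ^ 2 * σ A = k' := by
    rw [hA, hB, hsk]
    field_simp
  have e : A ^ 2 * σ B = k := by
    apply σ.injective
    rw [map_mul, map_pow, hσ, hA, hB, hsk]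
    field_simp
  have hx : QuadRel σ (quadAbs σ c) (quadNb σ (quadAbs σ c) (A + c'.1)) := quadRel_quadNb _ _
  have hy : QuadRel σ (quadAbs σ c') (quadNb σ (quadAbs σ c') (B + c.1)) := quadRel_quadNb _ _
  refine ⟨_, mem_quadPart.2 hx, _, mem_quadPart.2 hy, ?_, ?_⟩
  · intro h
    exact Finset.disjoint_left.1 (disjoint_quadPart hσ hcc) (mem_quadPart.2 hx)
      (h ▸ mem_quadPart.2 hy)
  · constructor
    · simp only [quadNb, quadAbs, Matrix.cons_val, map_add]
      linear_combination -e -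
        (A * c'.1 * σ B + σ c.1 * c.1 ^ 2 - c.2 + c'.2) * h2
    · simp only [quadNb, quadAbs, Matrix.cons_val, map_add]
      linear_combination -e' -
        (B * c.1 * σ A + σ c'.1 * c'.1 ^ 2 - c'.2 + c.2) * h2

open Classical in
-- Each of the two exceptional equations of `exists_adj_quadPart` determines the second coordinate
-- of `c'` from the first.
theorem card_filter_not_adj_quadPart_le [CharP K 2] (hσ : ∀ x, σ (σ x) = x ^ 2) (c : K × K) :
    (univ.filter fun c' => c ≠ c' ∧ ∀ x ∈ quadPart σ c, ∀ y ∈ quadPart σ c',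
      ¬ (quadGraph σ).Adj x y).card ≤ 2 * Fintype.card K := by
  have h1 : (univ.filter fun c' : K × K =>
      c.1 ^ 2 * σ c.1 - c.2 + c'.2 + c'.1 ^ 2 * σ c.1 = 0).card ≤ Fintype.card K := by
    refine card_le_card_of_injOn (t := univ) Prod.fst (by simp) ?_
    rintro ⟨a, p⟩ h ⟨a', p'⟩ h' heq
    simp only [coe_filter, mem_univ, true_and, Set.mem_ofPred_eq] at h h' heq
    subst heq
    have : p = p' := by linear_combination h - h'
    rw [this]
  have h2 : (univ.filter fun c' : K × K =>
      c'.1 ^ 2 * σ c'.1 - c'.2 + c.2 + c.1 ^ 2 * σ c'.1 = 0).card ≤ Fintype.card K := by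
    refine card_le_card_of_injOn (t := univ) Prod.fst (by simp) ?_
    rintro ⟨a, p⟩ h ⟨a', p'⟩ h' heq
    simp only [coe_filter, mem_univ, true_and, Set.mem_ofPred_eq] at h h' heq
    subst heq
    have : p = p' := by linear_combination h' - h
    rw [this]
  refine (card_le_card (t := (univ.filter fun c' : K × K =>
      c.1 ^ 2 * σ c.1 - c.2 + c'.2 + c'.1 ^ 2 * σ c.1 = 0) ∪ (univ.filter fun c' : K × K =>
      c'.1 ^ 2 * σ c'.1 - c'.2 + c.2 + c.1 ^ 2 * σ c'.1 = 0)) ?_).trans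
    ((card_union_le _ _).trans (by omega))
  intro c' hc'
  obtain ⟨hne, hno⟩ := (mem_filter.1 hc').2
  simp only [mem_union, mem_filter, mem_univ, true_and]
  by_contra! hcon
  obtain ⟨x, hx, y, hy, hxy⟩ := exists_adj_quadPart hσ hne hcon.1 hcon.2
  exact hno x hx y hy hxy

theorem exists_isRKGraph_of_quadrangle [CharP K 2] (hσ : ∀ x, σ (σ x) = x ^ 2) {t s : ℕ} (ht : 0 < t)
    (hs : 2 * Fintype.card K / t + (t + 1) ^ 6 < s) :
    ∃ (n : ℕ) (G : SimpleGraph (Fin n)), FamilyFree {C 4, C 6} G ∧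
      IsRKGraph G (Fintype.card K ^ 2) (Fintype.card K + s) := by
  classical
  have := exists_isRKGraph_of_few_missing (G := quadGraph σ) (L := 6) (by
      intro H hH
      simp only [Set.mem_insert_iff, Set.mem_singleton_iff] at hH
      rcases hH with rfl | rfl
      exacts [⟨4, by norm_num⟩, ⟨6, by norm_num⟩])
    (familyFree_quadGraph hσ) (quadPart σ) (fun i j hij => disjoint_quadPart hσ hij)
    (fun i => univ_nonempty.image _) (fun i => card_image_le.trans_eq card_univ)
    (fun i => le_trans (le_of_eq (by congr)) (card_filter_not_adj_quadPart_le hσ i)) ht hs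
  rwa [Fintype.card_prod, ← sq] at this

end QuadranglePolarity

/-! ### Asymptotics and conclusion -/

namespace CompletePartition

open Finset SimpleGraph Filter

theorem IsRKGraph.pos {n : ℕ} {G : SimpleGraph (Fin n)} {r k : ℕ} (h : IsRKGraph G r k)
    (hr : 2 ≤ r) : 0 < k := by
  classical
  rcases Nat.eq_zero_or_pos k with rfl | hk
  · obtain ⟨hn, hm⟩ := h.card_bounds
    obtain rfl : n = 0 := by simpa using hn
    have h1 : r * (r - 1) ≤ 0 := hm.trans_eq (by simp)
    have h2 : 0 < r * (r - 1) := Nat.mul_pos (by omega) (by omega)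
    omega
  · exact hk

/-- Constructions of `(r, (1 + o(1)) g)`-graphs and the matching trade-off between `r` and `k`
determine `f` asymptotically. -/
theorem isEquivalent_f {𝓗 : Family} {S : Set ℕ} {j L A c : ℕ} {F : ℕ → ℝ}
    (htrade : ∀ {n : ℕ} {G : SimpleGraph (Fin n)} {r k : ℕ}, IsRKGraph G r k → 2 ≤ r →
      FamilyFree 𝓗 G → (((r : ℝ) - 1) / k) ^ j * (((r : ℝ) - 1) / k - c) ≤ r * k)
    (hS : ∀ r ∈ S, ∃ q g : ℕ, 2 ≤ q ∧ q ≤ g ∧ g ≤ q ^ 2 ∧ g * q = r ∧ r * g = q ^ (j + 1) ∧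
      F r = g ∧ ∀ t s, 0 < t → A * g / t + (t + 1) ^ L < s →
        ∃ (n : ℕ) (G : SimpleGraph (Fin n)), FamilyFree 𝓗 G ∧ IsRKGraph G r (g + s)) :
    (fun r : ℕ => (f r 𝓗 : ℝ)) ~[atTop ⊓ principal S] F := by
  rw [Asymptotics.IsEquivalent, Asymptotics.isLittleO_iff]
  intro ε₀ hε₀
  obtain ⟨ε, hε, hε1, hεε⟩ : ∃ ε : ℝ, 0 < ε ∧ ε < 1 ∧ ε ≤ ε₀ :=
    ⟨min ε₀ (1 / 2), by positivity, (min_le_right _ _).trans_lt (by norm_num), min_le_left _ _⟩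
  -- This `t` makes A * g / t at most εg/2. Then `N` is large enough that q ≥ N gives (t + 1)^L + 1
  -- ≤ εg/2 and 1 + c < εq.
  obtain ⟨t, ht⟩ := exists_nat_gt (2 * (A : ℝ) / ε)
  have ht0 : (0 : ℝ) < t := lt_of_le_of_lt (by positivity) ht
  obtain ⟨N, hN⟩ := exists_nat_gt ((1 + (c : ℝ)) / ε + 2 * ((t + 1) ^ L + 1) / ε)
  rw [eventually_inf_principal]
  filter_upwards [eventually_ge_atTop (N ^ 3)] with r hr hrS
  obtain ⟨q, g, hq2, hqg, hgq2, hgq, hrg, hF, hex⟩ := hS r hrS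
  have hNq : N ≤ q := by
    have : N ^ 3 ≤ q ^ 3 := by
      refine hr.trans ?_
      rw [← hgq, pow_succ]
      gcongr
    exact le_of_pow_le_pow_left₀ (by norm_num) (by positivity) this
  have hNq' : (N : ℝ) ≤ q := by exact_mod_cast hNq
  have hqg' : (q : ℝ) ≤ g := by exact_mod_cast hqg
  have hq2' : (2 : ℝ) ≤ q := by exact_mod_cast hq2
  have hp1 : (0 : ℝ) ≤ (1 + (c : ℝ)) / ε := by positivity
  have hp2 : (0 : ℝ) ≤ 2 * ((t + 1) ^ L + 1) / ε := by positivity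
  have hr2 : 2 ≤ r := by
    rw [← hgq]
    nlinarith
  have hupper : (f r 𝓗 : ℝ) ≤ (1 + ε) * g := by
    have h1 : f r 𝓗 ≤ g + (A * g / t + (t + 1) ^ L + 1) :=
      Nat.sInf_le (hex t _ (by exact_mod_cast ht0) (Nat.lt_succ_self _))
    have h2 : ((A * g / t : ℕ) : ℝ) ≤ ε / 2 * g := by
      refine Nat.cast_div_le.trans ?_
      rw [div_le_iff₀ ht0]
      push_cast
      have h3 : (A : ℝ) ≤ ε / 2 * t := by
        rw [div_lt_iff₀ hε] at ht
        linarith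
      calc (A : ℝ) * g ≤ (ε / 2 * t) * g := by gcongr
        _ = ε / 2 * g * t := by ring
    have h4 : ((t : ℝ) + 1) ^ L + 1 ≤ ε / 2 * g := by
      have : 2 * (((t : ℝ) + 1) ^ L + 1) / ε ≤ g := by linarith
      rw [div_le_iff₀ hε] at this
      linarith
    have h5 : (f r 𝓗 : ℝ) ≤ g + (((A * g / t : ℕ) : ℝ) + ((t : ℝ) + 1) ^ L + 1) := by
      exact_mod_cast h1
    linarith
  have hlower : (1 - ε) * g ≤ (f r 𝓗 : ℝ) := by
    have hne : {k : ℕ | ∃ (n : ℕ) (G : SimpleGraph (Fin n)),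
        FamilyFree 𝓗 G ∧ IsRKGraph G r k}.Nonempty :=
      ⟨_, hex t _ (by exact_mod_cast ht0) (Nat.lt_succ_self _)⟩
    obtain ⟨n, G, hfree, hG⟩ := Nat.sInf_mem hne
    have hG' : IsRKGraph G r (f r 𝓗) := hG
    refine le_of_pow_mul_le (j := j) (q := q) (r := r) (c := c) (by linarith) hε hε1 ?_
      (by positivity) (by exact_mod_cast hG'.pos hr2) (by linarith) (by exact_mod_cast hgq)
      (by linarith) (by exact_mod_cast hrg) (htrade hG' hr2 hfree)
    have : (1 + (c : ℝ)) / ε < q := by linarith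
    rw [div_lt_iff₀ hε] at this
    linarith
  have hg0 : (0 : ℝ) ≤ g := by positivity
  rw [Pi.sub_apply, hF, Real.norm_eq_abs, Real.norm_eq_abs, abs_of_nonneg hg0, abs_le]
  have := mul_le_mul_of_nonneg_right hεε hg0
  constructor <;> linarith

theorem exists_twist (p e : ℕ) [Fact p.Prime] : ∃ (K : Type) (_ : Field K) (_ : Fintype K)
    (_ : CharP K p) (σ : K →+* K), Fintype.card K = p ^ (2 * e + 1) ∧ ∀ x, σ (σ x) = x ^ p := by
  have hcard := GaloisField.card p (2 * e + 1) (by omega)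
  have hfin : Finite (GaloisField p (2 * e + 1)) := Nat.finite_of_card_ne_zero (by
    rw [hcard]
    exact pow_ne_zero _ (Fact.out : p.Prime).ne_zero)
  have := Fintype.ofFinite (GaloisField p (2 * e + 1))
  obtain ⟨σ, hσ⟩ := exists_ringHom_comp_self_eq_pow (K := GaloisField p (2 * e + 1)) p e hcard
  exact ⟨GaloisField p (2 * e + 1), inferInstance, inferInstance, inferInstance, σ,
    by rw [← Nat.card_eq_fintype_card, hcard], hσ⟩

theorem infinite_range_odd_powers {a b : ℕ} (ha : 2 ≤ a) (hb : 0 < b) :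
    {r : ℕ | ∃ e, 1 ≤ e ∧ r = a ^ (b * (2 * e + 1))}.Infinite := by
  refine Set.infinite_of_injective_forall_mem (f := fun e : ℕ => a ^ (b * (2 * (e + 1) + 1))) ?_
    fun e => ⟨e + 1, by omega, rfl⟩
  intro e e' h
  have h1 := Nat.pow_right_injective ha h
  have h2 := Nat.eq_of_mul_eq_mul_left hb h1
  omega

end CompletePartition

theorem corollary4 :
    (∃ S : Set ℕ, S.Infinite ∧ (∀ e : ℕ, 1 ≤ e → 2 ^ (2 * (2 * e + 1)) ∈ S) ∧
      (fun r : ℕ => (CompletePartition.f r {CompletePartition.C 4, CompletePartition.C 6} : ℝ))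
        ~[Filter.atTop ⊓ Filter.principal S] (fun r : ℕ => (r : ℝ) ^ (1 / 2 : ℝ))) ∧
    (∃ T : Set ℕ, T.Infinite ∧ (∀ e : ℕ, 1 ≤ e → 3 ^ (3 * (2 * e + 1)) ∈ T) ∧
      (fun ρ : ℕ => (CompletePartition.f ρ {CompletePartition.C 4, CompletePartition.C 6,
          CompletePartition.C 8, CompletePartition.C 10} : ℝ))
        ~[Filter.atTop ⊓ Filter.principal T] (fun ρ : ℕ => (ρ : ℝ) ^ (2 / 3 : ℝ))) := by
  constructor
  · refine ⟨_, CompletePartition.infinite_range_odd_powers (a := 2) (b := 2) le_rfl two_pos,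
      fun e he => ⟨e, he, rfl⟩, ?_⟩
    -- Here r = q² and g = q, where q is the order of the field, so rg = q³.
    refine CompletePartition.isEquivalent_f (j := 2) (L := 6) (A := 2) (c := 12)
      (fun h hr hG => by exact_mod_cast h.sq_mul_le hr hG) ?_
    rintro r ⟨e, he, rfl⟩
    have hr : (2 : ℕ) ^ (2 * (2 * e + 1)) = (2 ^ (2 * e + 1)) ^ 2 := by rw [← pow_mul, mul_comm]
    rw [hr]
    obtain ⟨K, _, _, _, σ, hcard, hσ⟩ := CompletePartition.exists_twist 2 e
    rw [← hcard]
    classical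
    have h2 : 2 ≤ Fintype.card K := by
      rw [hcard]
      exact Nat.le_self_pow (by omega) 2
    refine ⟨Fintype.card K, Fintype.card K, h2, le_rfl, Nat.le_self_pow two_ne_zero _, by ring,
      by ring, ?_, fun t s ht hs => exists_isRKGraph_of_quadrangle hσ ht hs⟩
    rw [Nat.cast_pow, ← Real.sqrt_eq_rpow, Real.sqrt_sq (by positivity)]
  · refine ⟨_, CompletePartition.infinite_range_odd_powers (a := 3) (b := 3) (by norm_num)
      three_pos, fun e he => ⟨e, he, rfl⟩, ?_⟩
    -- Here r = q³ and g = q², so rg = q⁵.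
    refine CompletePartition.isEquivalent_f (j := 4) (L := 10) (A := 20) (c := 40)
      (fun h hr hG => by exact_mod_cast h.pow_four_mul_le hr hG) ?_
    rintro r ⟨e, he, rfl⟩
    have hr : (3 : ℕ) ^ (3 * (2 * e + 1)) = (3 ^ (2 * e + 1)) ^ 3 := by rw [← pow_mul, mul_comm]
    rw [hr]
    obtain ⟨K, _, _, _, σ, hcard, hσ⟩ := CompletePartition.exists_twist 3 e
    rw [← hcard]
    classical
    have h3 : 3 ≤ Fintype.card K := by
      rw [hcard]
      exact Nat.le_self_pow (by omega) 3
    refine ⟨Fintype.card K, Fintype.card K ^ 2, by omega, Nat.le_self_pow two_ne_zero _, le_rfl,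
      by ring, by ring, ?_, fun t s ht hs => exists_isRKGraph_of_hexagon hσ ht hs⟩
    rw [Nat.cast_pow, Nat.cast_pow, ← Real.rpow_natCast, ← Real.rpow_natCast,
      ← Real.rpow_mul (by positivity)]
    norm_num
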